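/- Let $K$ be a nonzero commutative unital ring and $n\ge 2$ an integer. An $n$-Lie algebra over $K$ is a $K$-module $L$ with an alternating $n$-linear bracket such that $$[[x_1,\dots,x_n],y_1,\dots,y_{n-1}]=\sum_{i=1}^n[x_1,\dots,x_{i-1},[x_i,y_1,\dots,y_{n-1}],x_{i+1},\dots,x_n];$$ with the bracket-preserving linear maps these form the category $n\text{-}\mathsf{Lie}_K$. For an $n$-Lie algebra $L$, the category $L\text{-}\mathsf{Mod}_K$ of $L$-modules is the category of abelian group objects in the comma category $(n\text{-}\mathsf{Lie}_K\downarrow L)$. Let $\mathsf{Alg}_K$ be the category of associative unital $K$-algebras, and for an algebra $A$ let $\mathsf{Mod}_A$ be the category of $A$-modules. The associated algebra functor $U\colon n\text{-}\mathsf{Lie}_K\to\mathsf{Alg}_K$ sends $L$ to the quotient of the tensor algebra of $\Lambda^{n-1}L$ by the two-sided ideal generated by the relations $$(x_1\wedge\cdots\wedge x_{n-1})(y_1\wedge\cdots\wedge y_{n-1})-(y_1\wedge\cdots\wedge y_{n-1})(x_1\wedge\cdots\wedge x_{n-1})=\sum_{i=1}^{n-1}y_1\wedge\cdots\wedge[x_1,\dots,x_{n-1},y_i]\wedge\cdots\wedge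 y_{n-1},$$ $$[x_1,\dots,x_n]\wedge y_2\wedge\cdots\wedge y_{n-1}=\sum_{i=1}^{n}(-1)^{n-i}(x_1\wedge\cdots\wedge\widehat{x_i}\wedge\cdots\wedge x_n)(x_i\wedge y_2\wedge\cdots\wedge y_{n-1})$$ for all $x_i,y_i\in L$, and a homomorphism $f$ to the algebra map induced by $\Lambda^{n-1}f$. Then: (a) for every $n$-Lie algebra $L$ the categories $L\text{-}\mathsf{Mod}_K$ and $\mathsf{Mod}_{U(L)}$ are equivalent; (b) the functor $U$ has a right adjoint if and only if $n=2$; (c) more strongly, if $n>2$ there is no functor $F\colon n\text{-}\mathsf{Lie}_K\to\mathsf{Alg}_K$ that has a right adjoint $G\colon\mathsf{Alg}_K\to n\text{-}\mathsf{Lie}_K$ and for which the categories $L\text{-}\mathsf{Mod}_K$ and $\mathsf{Mod}_{F(L)}$ are equivalent for every $n$-Lie algebra $L$. -/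

import Mathlib

open CategoryTheory

universe u

/-- An `n`-Lie algebra over `K` of arity `n = k + 2` (so `k : ℕ` ranges over all arities `n ≥ 2`):
a `K`-module with an alternating `n`-linear bracket satisfying
`[[x₁, …, xₙ], y₁, …, yₙ₋₁] = ∑ᵢ [x₁, …, [xᵢ, y₁, …, yₙ₋₁], …, xₙ]`. -/
structure NLieAlg (K : Type u) [CommRing K] (k : ℕ) : Type (u + 1) where
  carrier : Type u
  [isAddCommGroup : AddCommGroup carrier]
  [isModule : Module K carrier]
  bracket : carrier [⋀^Fin (k + 2)]→ₗ[K] carrier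
  fundamental : ∀ (x : Fin (k + 2) → carrier) (y : Fin (k + 1) → carrier),
    bracket (Fin.cons (bracket x) y) =
      ∑ i, bracket (Function.update x i (bracket (Fin.cons (x i) y)))

namespace NLieAlg

attribute [instance] NLieAlg.isAddCommGroup NLieAlg.isModule

variable {K : Type u} [CommRing K] {k : ℕ}

instance : CoeSort (NLieAlg K k) (Type u) := ⟨NLieAlg.carrier⟩

/-- Homomorphisms of `n`-Lie algebras: linear maps that preserve the bracket. -/
@[ext]
structure Hom (L L' : NLieAlg K k) : Type u where
  lin : L →ₗ[K] L'
  map_bracket : ∀ x : Fin (k + 2) → L, lin (L.bracket x) = L'.bracket (fun i => lin (x i))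

/-- The category of `n`-Lie algebras over `K`, where `n = k + 2`. -/
instance : Category (NLieAlg K k) where
  Hom L L' := Hom L L'
  id L := ⟨LinearMap.id, fun _ => rfl⟩
  comp f g := ⟨g.lin ∘ₗ f.lin, fun x => by
    simp [LinearMap.comp_apply, f.map_bracket, g.map_bracket]⟩

@[ext]
theorem hom_ext {L L' : NLieAlg K k} {f g : L ⟶ L'} (h : ∀ x, f.lin x = g.lin x) : f = g :=
  Hom.ext (LinearMap.ext h)

@[simp]
theorem id_lin (L : NLieAlg K k) : Hom.lin (𝟙 L) = LinearMap.id := rfl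

@[simp]
theorem comp_lin {L L' L'' : NLieAlg K k} (f : L ⟶ L') (g : L' ⟶ L'') :
    (f ≫ g).lin = g.lin ∘ₗ f.lin := rfl

/-! ### Fibre products and modules -/

section FibreProduct

variable {A B L : NLieAlg K k} (f : A ⟶ L) (g : B ⟶ L)

/-- The underlying module `{(a, b) | f a = g b}` of the fibre product. -/
def fibreSubmodule : Submodule K (A × B) :=
  LinearMap.eqLocus (f.lin ∘ₗ LinearMap.fst K A B) (g.lin ∘ₗ LinearMap.snd K A B)

theorem mem_fibreSubmodule (p : A × B) :
    p ∈ fibreSubmodule f g ↔ f.lin p.1 = g.lin p.2 := Iff.rfl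

/-- The componentwise bracket on the fibre product. -/
def fibreBracket : fibreSubmodule f g [⋀^Fin (k + 2)]→ₗ[K] fibreSubmodule f g :=
  ((A.bracket.compLinearMap (LinearMap.fst K A B ∘ₗ (fibreSubmodule f g).subtype)).prod
    (B.bracket.compLinearMap (LinearMap.snd K A B ∘ₗ (fibreSubmodule f g).subtype))).codRestrict
      (fibreSubmodule f g) fun v => by
    rw [mem_fibreSubmodule]
    change f.lin (A.bracket fun i => (v i).1.1) = g.lin (B.bracket fun i => (v i).1.2)
    rw [f.map_bracket, g.map_bracket]
    exact congrArg L.bracket (funext fun i => (v i).2)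

theorem fibreBracket_fst (v : Fin (k + 2) → fibreSubmodule f g) :
    (fibreBracket f g v).1.1 = A.bracket (fun i => (v i).1.1) := rfl

theorem fibreBracket_snd (v : Fin (k + 2) → fibreSubmodule f g) :
    (fibreBracket f g v).1.2 = B.bracket (fun i => (v i).1.2) := rfl

/-- The fibre product `A ×_L B` of `n`-Lie algebras. -/
def fibreProd : NLieAlg K k where
  carrier := fibreSubmodule f g
  bracket := fibreBracket f g
  fundamental x y := by
    have hc : ∀ {C : Type u} (φ : fibreSubmodule f g → C) (a : fibreSubmodule f g),
        (fun i => φ ((Fin.cons a y : Fin (k + 2) → fibreSubmodule f g) i)) =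
          Fin.cons (φ a) (fun i => φ (y i)) := fun φ a => by
      funext i; refine Fin.cases ?_ (fun j => ?_) i <;> simp
    have hu : ∀ {C : Type u} (φ : fibreSubmodule f g → C) (i : Fin (k + 2))
        (a : fibreSubmodule f g), (fun j => φ (Function.update x i a j)) =
          Function.update (fun j => φ (x j)) i (φ a) := fun φ i a => by
      funext j
      exact Function.apply_update (fun _ => φ) x i a j
    apply Subtype.ext
    apply Prod.ext
    · rw [fibreBracket_fst, hc (fun p => p.1.1), fibreBracket_fst, A.fundamental,
        Submodule.coe_sum, Prod.fst_sum]
      refine Finset.sum_congr rfl fun i _ => ?_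
      rw [fibreBracket_fst, hu (fun p => p.1.1), fibreBracket_fst, hc (fun p => p.1.1)]
    · rw [fibreBracket_snd, hc (fun p => p.1.2), fibreBracket_snd, B.fundamental,
        Submodule.coe_sum, Prod.snd_sum]
      refine Finset.sum_congr rfl fun i _ => ?_
      rw [fibreBracket_snd, hu (fun p => p.1.2), fibreBracket_snd, hc (fun p => p.1.2)]

/-- The first projection of the fibre product. -/
def fibreFst : fibreProd f g ⟶ A :=
  Hom.mk (LinearMap.fst K A B ∘ₗ (fibreSubmodule f g).subtype) fun _ => rfl

/-- The second projection of the fibre product. -/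
def fibreSnd : fibreProd f g ⟶ B :=
  Hom.mk (LinearMap.snd K A B ∘ₗ (fibreSubmodule f g).subtype) fun _ => rfl

theorem fibre_condition : fibreFst f g ≫ f = fibreSnd f g ≫ g :=
  hom_ext fun p => p.2

/-- The map into the fibre product induced by a commutative square. -/
def fibreLift {C : NLieAlg K k} (a : C ⟶ A) (b : C ⟶ B) (h : a ≫ f = b ≫ g) :
    C ⟶ fibreProd f g :=
  Hom.mk ((a.lin.prod b.lin).codRestrict (fibreSubmodule f g)
      fun c => congrArg (fun φ : C ⟶ L => φ.lin c) h) fun x =>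
    Subtype.ext (Prod.ext (a.map_bracket x) (b.map_bracket x))

/-- The fibre product is a pullback. -/
def fibreIsLimit : Limits.IsLimit
    (Limits.PullbackCone.mk (fibreFst f g) (fibreSnd f g) (fibre_condition f g)) :=
  Limits.PullbackCone.IsLimit.mk _
    (fun s => fibreLift f g s.fst s.snd s.condition)
    (fun _ => rfl) (fun _ => rfl)
    (fun s _ h₁ h₂ => hom_ext fun c => Subtype.ext (Prod.ext
      (congrArg (fun φ : s.pt ⟶ A => φ.lin c) h₁) (congrArg (fun φ : s.pt ⟶ B => φ.lin c) h₂)))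

end FibreProduct

/-- The finite products in the comma category `n-Lie ↓ L`: the terminal object is `L` itself,
binary products are fibre products over `L`. -/
instance (L : NLieAlg K k) : CartesianMonoidalCategory (Over L) :=
  .ofChosenFiniteProducts
    ⟨Limits.asEmptyCone (Over.mk (𝟙 L)), Limits.IsTerminal.ofUniqueHom (fun Y => Over.homMk Y.hom)
      fun _ m => Over.OverMorphism.ext (by simpa using m.w)⟩
    fun Y Z => ⟨Limits.pullbackConeEquivBinaryFan.functor.obj
        (Limits.PullbackCone.mk (fibreFst Y.hom Z.hom) (fibreSnd Y.hom Z.hom)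
          (fibre_condition Y.hom Z.hom)),
      (fibreIsLimit Y.hom Z.hom).pullbackConeEquivBinaryFanFunctor⟩

instance (L : NLieAlg K k) : BraidedCategory (Over L) :=
  .ofCartesianMonoidalCategory

/-- The category of modules over the `n`-Lie algebra `L`: abelian group objects in the comma
category `n-Lie ↓ L`. -/
abbrev LMod (L : NLieAlg K k) : Type (u + 1) := CommGrp (Over L)

/-! ### The associated algebra -/

/-- The element `x₁ ∧ ⋯ ∧ xₙ₋₁` of the tensor algebra of `Λⁿ⁻¹ L`. -/
noncomputable def wedge (L : NLieAlg K k) (x : Fin (k + 1) → L) :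
    TensorAlgebra K (⋀[K]^(k + 1) L) :=
  TensorAlgebra.ι K (exteriorPower.ιMulti K (k + 1) x)

/-- The defining relations of the associated algebra of an `n`-Lie algebra.
In the second one `i` is counted from `0`, so that the sign `(-1)ⁿ⁻ⁱ` becomes
`(-1) ^ (k + 1 - i)`. -/
inductive AssocRel (L : NLieAlg K k) :
    TensorAlgebra K (⋀[K]^(k + 1) L) → TensorAlgebra K (⋀[K]^(k + 1) L) → Prop
  | commutator (x y : Fin (k + 1) → L) :
      AssocRel L (L.wedge x * L.wedge y - L.wedge y * L.wedge x)
        (∑ i, L.wedge (Function.update y i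
          (L.bracket (Fin.snoc (α := fun _ => L.carrier) x (y i)))))
  | bracket (x : Fin (k + 2) → L) (y : Fin k → L) :
      AssocRel L (L.wedge (Fin.cons (L.bracket x) y))
        (∑ i : Fin (k + 2), (-1) ^ (k + 1 - (i : ℕ)) *
          (L.wedge (fun j => x (i.succAbove j)) * L.wedge (Fin.cons (x i) y)))

/-- The associated algebra `U(L)`: the tensor algebra of `Λⁿ⁻¹ L` modulo the two-sided ideal
generated by the relations `AssocRel`. -/
abbrev AssocAlg (L : NLieAlg K k) : Type u := RingQuot (AssocRel L)

/-- The class of `x₁ ∧ ⋯ ∧ xₙ₋₁` in `U(L)`. -/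
noncomputable def gen (L : NLieAlg K k) (x : Fin (k + 1) → L) : AssocAlg L :=
  RingQuot.mkAlgHom K (AssocRel L) (L.wedge x)

theorem assocAlg_hom_ext {L : NLieAlg K k} {R : Type u} [Ring R] [Algebra K R]
    {φ ψ : AssocAlg L →ₐ[K] R} (h : ∀ x, φ (L.gen x) = ψ (L.gen x)) : φ = ψ := by
  apply RingQuot.ringQuot_ext'
  apply TensorAlgebra.hom_ext
  apply exteriorPower.linearMap_ext
  ext x
  exact h x

/-- The map of tensor algebras induced by a homomorphism of `n`-Lie algebras. -/
noncomputable def tensorMap {L L' : NLieAlg K k} (f : L ⟶ L') :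
    TensorAlgebra K (⋀[K]^(k + 1) L) →ₐ[K] TensorAlgebra K (⋀[K]^(k + 1) L') :=
  TensorAlgebra.lift K (TensorAlgebra.ι K ∘ₗ exteriorPower.map (k + 1) f.lin)

theorem tensorMap_wedge {L L' : NLieAlg K k} (f : L ⟶ L') (x : Fin (k + 1) → L) :
    tensorMap f (L.wedge x) = L'.wedge (fun i => f.lin (x i)) := by
  simp only [tensorMap, wedge, TensorAlgebra.lift_ι_apply, LinearMap.comp_apply,
    exteriorPower.map_apply_ιMulti]
  rfl

theorem tensorMap_rel {L L' : NLieAlg K k} (f : L ⟶ L') {a b : TensorAlgebra K (⋀[K]^(k + 1) L)}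
    (h : AssocRel L a b) : AssocRel L' (tensorMap f a) (tensorMap f b) := by
  have hcons : ∀ {m : ℕ} (a : L) (y : Fin m → L),
      (fun i => f.lin ((Fin.cons a y : Fin (m + 1) → L) i)) =
        (Fin.cons (f.lin a) (fun i => f.lin (y i)) : Fin (m + 1) → L') := fun a y => by
    funext i; refine Fin.cases ?_ (fun j => ?_) i <;> simp
  have hsnoc : ∀ {m : ℕ} (a : L) (y : Fin m → L),
      (fun i => f.lin ((Fin.snoc y a : Fin (m + 1) → L) i)) =
        (Fin.snoc (fun i => f.lin (y i)) (f.lin a) : Fin (m + 1) → L') := fun a y => by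
    funext i; refine Fin.lastCases ?_ (fun j => ?_) i <;> simp
  have hupd : ∀ {m : ℕ} (y : Fin m → L) (i : Fin m) (a : L),
      (fun j => f.lin (Function.update y i a j)) =
        Function.update (fun j => f.lin (y j)) i (f.lin a) := fun y i a => by
    funext j
    exact Function.apply_update (fun _ => f.lin) y i a j
  cases h with
  | commutator x y =>
    simp only [map_sub, map_mul, map_sum, tensorMap_wedge, hupd, f.map_bracket, hsnoc]
    exact AssocRel.commutator _ _
  | bracket x y =>
    simp only [map_mul, map_sum, map_pow, map_neg, map_one, tensorMap_wedge, hcons, f.map_bracket]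
    exact AssocRel.bracket _ _

/-- The algebra homomorphism `U(f)`, sending `x₁ ∧ ⋯ ∧ xₙ₋₁` to `f x₁ ∧ ⋯ ∧ f xₙ₋₁`. -/
noncomputable def assocMap {L L' : NLieAlg K k} (f : L ⟶ L') : AssocAlg L →ₐ[K] AssocAlg L' :=
  RingQuot.liftAlgHom K ⟨(RingQuot.mkAlgHom K (AssocRel L')).comp (tensorMap f),
    fun _ _ h => RingQuot.mkAlgHom_rel K (tensorMap_rel f h)⟩

theorem assocMap_gen {L L' : NLieAlg K k} (f : L ⟶ L') (x : Fin (k + 1) → L) :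
    assocMap f (L.gen x) = L'.gen (fun i => f.lin (x i)) := by
  refine (RingQuot.liftAlgHom_mkAlgHom_apply K _ _ _).trans ?_
  exact congrArg _ (tensorMap_wedge f x)

variable (K k) in
/-- The associated algebra functor `U` from `n`-Lie algebras to associative unital algebras. -/
noncomputable def assocFunctor : NLieAlg K k ⥤ AlgCat.{u} K where
  obj L := AlgCat.of K (AssocAlg L)
  map f := AlgCat.ofHom (assocMap f)
  map_id L := by
    apply AlgCat.hom_ext
    apply assocAlg_hom_ext
    intro x
    exact assocMap_gen _ x
  map_comp f g := by
    apply AlgCat.hom_ext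
    apply assocAlg_hom_ext
    intro x
    change assocMap (f ≫ g) (gen _ x) = assocMap g (assocMap f (gen _ x))
    simp only [assocMap_gen]
    rfl

end NLieAlg

/-! For (a), an abelian group object over `L` has a unit, so its projection to `L` is split. By
linearity its multiplication must be `e + e' - s(π e)` (`mul_pair`), and compatibility of this
formula with the bracket means that brackets with two or more entries from the kernel contribute
nothing (`bracket_eq_of_add`). The object is therefore determined by the maps `m ↦ [s x₁, …, s xₙ₋₁,
m]` on the kernel of `π`. The fundamental identity for these maps gives the two relations of `U(L)`.
Conversely, the two relations are what make `L × M` an `n`-Lie algebra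
(`IsAssocMap.actionMap_fundamental`). Hence `kerFunctor` is an equivalence.

For (c), suppose `F ⊣ G` and `F(L)` is Morita equivalent to `U(L)` for every `L`. Put `A = F(K)`,
where `K` is the free `n`-Lie algebra on one generator. When `n > 2`, any two elements of any `L`
define a homomorphism from the abelian algebra `K²`, so any two maps out of `A` extend to `F(K²)`.
Since `U(K²)` is commutative, `F(K²)` is Morita equivalent to a commutative ring. Over such a ring,
if `a V ⊆ W` and `b W = 0`, then not only `b a V = 0` but also `a b V = 0`
(`smul_smul_eq_zero_of_equivalence`). Applied to a suitable action on `A ⊗ A`, this gives `a ⊗ b =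
0` for `a`, `b` in the augmentation ideal of `A` (`tmul_eq_zero_of_equivalence`). Any two maps from
`A` then have commuting images. The adjunction makes `F(L)` generated by images of `A`, so every
`F(L)` is commutative. But `U(detAlg)` is not Morita equivalent to a commutative ring: its adjoint
module violates the criterion (`isEmpty_equivalence_detAlg`).

For (b), `U` satisfies the module condition by (a), so (c) excludes `n > 2`; for `n = 2` the
commutator functor is right adjoint. -/

namespace AlternatingMap

/-! ### Sign rules for moving an entry of an alternating map. -/

variable {R M N : Type*} [CommRing R] [AddCommGroup M] [AddCommGroup N] [Module R M] [Module R N]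
  {n : ℕ}

theorem map_update_eq_cons (f : M [⋀^Fin (n + 1)]→ₗ[R] N) (x : Fin (n + 1) → M) (i : Fin (n + 1))
    (m : M) :
    f (Function.update x i m) =
      (-1 : ℤ) ^ (i : ℕ) • f (Fin.cons m (fun j => x (i.succAbove j))) := by
  have h := f.map_insertNth i m (i.removeNth x)
  rw [Fin.insertNth_removeNth] at h
  exact h

theorem map_snoc_eq_cons (f : M [⋀^Fin (n + 1)]→ₗ[R] N) (v : Fin n → M) (m : M) :
    f (Fin.snoc (α := fun _ => M) v m) = (-1 : ℤ) ^ n • f (Fin.cons m v) := by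
  have h := f.map_insertNth (Fin.last n) m v
  rw [Fin.insertNth_last'] at h
  simpa [Matrix.vecCons] using h

theorem map_cons_eq_snoc (f : M [⋀^Fin (n + 1)]→ₗ[R] N) (v : Fin n → M) (m : M) :
    f (Fin.cons m v) = (-1 : ℤ) ^ n • f (Fin.snoc (α := fun _ => M) v m) := by
  rw [map_snoc_eq_cons, smul_smul, ← mul_pow]
  simp

end AlternatingMap

/-- The natural subtraction is never truncated, because `i ≤ k + 1`. -/
theorem neg_one_pow_sub_eq {k : ℕ} (i : Fin (k + 2)) :
    (-1 : ℤ) ^ (k + 1 - (i : ℕ)) = (-1) ^ (k + 1) * (-1) ^ (i : ℕ) := by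
  have h : k + 1 = (k + 1 - (i : ℕ)) + i := by omega
  conv_rhs => rw [h, pow_add, mul_assoc, ← mul_pow]
  simp

theorem Fin.update_succAbove_comp {α : Type*} {n : ℕ} (x : Fin (n + 1) → α) (i : Fin (n + 1))
    (j : Fin n) (z : α) :
    (fun l => Function.update x (i.succAbove j) z (i.succAbove l)) =
      Function.update (fun l => x (i.succAbove l)) j z := by
  funext l
  simp [Function.update_apply]

namespace NLieAlg

variable {K : Type u} [CommRing K] {k : ℕ}

/-! ### Universal property of the associated algebra. -/

section Universal

variable {L : NLieAlg K k} {R : Type*} [Ring R] [Algebra K R]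

/-- The condition on an alternating map `Lⁿ⁻¹ → R` into an associative algebra under which it
extends to the associated algebra of `L`. -/
structure IsAssocMap (ρ : L [⋀^Fin (k + 1)]→ₗ[K] R) : Prop where
  commutator : ∀ x y : Fin (k + 1) → L, ρ x * ρ y - ρ y * ρ x =
    ∑ i, ρ (Function.update y i (L.bracket (Fin.snoc (α := fun _ => L.carrier) x (y i))))
  bracket : ∀ (x : Fin (k + 2) → L) (y : Fin k → L), ρ (Fin.cons (L.bracket x) y) =
    ∑ i : Fin (k + 2), (-1 : ℤ) ^ (k + 1 - (i : ℕ)) •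
      (ρ (fun j => x (i.succAbove j)) * ρ (Fin.cons (x i) y))

/-- The algebra homomorphism from the associated algebra induced by an alternating map. -/
noncomputable def assocLift (ρ : L [⋀^Fin (k + 1)]→ₗ[K] R) (h : IsAssocMap ρ) :
    AssocAlg L →ₐ[K] R :=
  have hw : ∀ x, TensorAlgebra.lift K (exteriorPower.alternatingMapLinearEquiv ρ) (L.wedge x) =
      ρ x := fun x => by
    rw [wedge, TensorAlgebra.lift_ι_apply, exteriorPower.alternatingMapLinearEquiv_apply_ιMulti]
  RingQuot.liftAlgHom K ⟨TensorAlgebra.lift K (exteriorPower.alternatingMapLinearEquiv ρ), by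
    rintro _ _ (⟨x, y⟩ | ⟨x, y⟩)
    · simp only [map_sub, map_mul, map_sum, hw]
      exact h.commutator x y
    · simp only [map_mul, map_sum, map_pow, map_neg, map_one, hw]
      rw [h.bracket]
      refine Finset.sum_congr rfl fun i _ => ?_
      rw [zsmul_eq_mul]
      simp⟩

@[simp]
theorem assocLift_gen (ρ : L [⋀^Fin (k + 1)]→ₗ[K] R) (h : IsAssocMap ρ) (x : Fin (k + 1) → L) :
    assocLift ρ h (L.gen x) = ρ x := by
  refine (RingQuot.liftAlgHom_mkAlgHom_apply K _ _ _).trans ?_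
  rw [wedge, TensorAlgebra.lift_ι_apply, exteriorPower.alternatingMapLinearEquiv_apply_ιMulti]

variable (L) in
/-- The alternating map of generators of the associated algebra. -/
noncomputable def genMap : L [⋀^Fin (k + 1)]→ₗ[K] AssocAlg L :=
  ((RingQuot.mkAlgHom K (AssocRel L)).toLinearMap ∘ₗ TensorAlgebra.ι K).compAlternatingMap
    (exteriorPower.ιMulti K (k + 1))

theorem gen_commutator (x y : Fin (k + 1) → L) : L.gen x * L.gen y - L.gen y * L.gen x =
    ∑ i, L.gen (Function.update y i (L.bracket (Fin.snoc (α := fun _ => L.carrier) x (y i)))) := by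
  have h := RingQuot.mkAlgHom_rel K (AssocRel.commutator x y)
  simp only [map_sub, map_mul, map_sum] at h
  exact h

theorem gen_bracket (x : Fin (k + 2) → L) (y : Fin k → L) : L.gen (Fin.cons (L.bracket x) y) =
    ∑ i : Fin (k + 2), (-1 : ℤ) ^ (k + 1 - (i : ℕ)) •
      (L.gen (fun j => x (i.succAbove j)) * L.gen (Fin.cons (x i) y)) := by
  have h := RingQuot.mkAlgHom_rel K (AssocRel.bracket x y)
  simp only [map_mul, map_sum, map_pow, map_neg, map_one] at h
  refine h.trans (Finset.sum_congr rfl fun i _ => ?_)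
  rw [zsmul_eq_mul]
  simp [gen]

theorem isAssocMap_genMap : IsAssocMap (genMap L) := ⟨gen_commutator, gen_bracket⟩

theorem IsAssocMap.comp {ρ : L [⋀^Fin (k + 1)]→ₗ[K] R} (h : IsAssocMap ρ) {R' : Type*} [Ring R']
    [Algebra K R'] (φ : R →ₐ[K] R') : IsAssocMap (φ.toLinearMap.compAlternatingMap ρ) where
  commutator x y := by
    simpa using congrArg φ (h.commutator x y)
  bracket x y := by
    simpa using congrArg φ (h.bracket x y)

/-- A subalgebra of the associated algebra containing all generators is everything. -/
theorem mem_of_gen_mem (S : Subalgebra K (AssocAlg L)) (h : ∀ x, L.gen x ∈ S) (a : AssocAlg L) :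
    a ∈ S := by
  obtain ⟨t, rfl⟩ := RingQuot.mkAlgHom_surjective K (AssocRel L) a
  have hι : ∀ w : ⋀[K]^(k + 1) L,
      RingQuot.mkAlgHom K (AssocRel L) (TensorAlgebra.ι K w) ∈ S.toSubmodule := fun w => by
    have hw : w ∈ Submodule.span K (Set.range (exteriorPower.ιMulti K (k + 1) (M := L))) := by
      rw [exteriorPower.ιMulti_span]
      trivial
    induction hw using Submodule.span_induction with
    | mem w hw =>
      obtain ⟨x, rfl⟩ := hw
      exact h x
    | zero => simp
    | add v w _ _ hv hw =>
      rw [map_add, map_add]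
      exact add_mem hv hw
    | smul r w _ hw =>
      rw [map_smul, map_smul]
      exact S.toSubmodule.smul_mem r hw
  have ht : t ∈ Algebra.adjoin K (Set.range (TensorAlgebra.ι K (M := ⋀[K]^(k + 1) L))) := by
    rw [TensorAlgebra.adjoin_range_ι]
    trivial
  have hle : Algebra.adjoin K (Set.range (TensorAlgebra.ι K (M := ⋀[K]^(k + 1) L))) ≤
      S.comap (RingQuot.mkAlgHom K (AssocRel L)) := by
    rw [Algebra.adjoin_le_iff]
    rintro _ ⟨w, rfl⟩
    exact hι w
  exact hle ht

end Universal

/-- Both sides are the sum of `f` over all off-diagonal pairs. -/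
theorem _root_.Fin.sum_sum_succAbove_comm {N : Type*} [AddCommGroup N] {n : ℕ}
    (f : Fin (n + 1) → Fin (n + 1) → N) :
    ∑ i, ∑ j : Fin n, f i (i.succAbove j) = ∑ i, ∑ j : Fin n, f (i.succAbove j) i := by
  have h₁ : ∑ i, ∑ j : Fin n, f i (i.succAbove j) = ∑ i, ∑ j, f i j - ∑ i, f i i := by
    rw [← Finset.sum_sub_distrib]
    refine Finset.sum_congr rfl fun i _ => ?_
    rw [Fin.sum_univ_succAbove (f i) i, add_sub_cancel_left]
  have h₂ : ∑ i, ∑ j : Fin n, f (i.succAbove j) i = ∑ i, ∑ j, f j i - ∑ i, f i i := by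
    rw [← Finset.sum_sub_distrib]
    refine Finset.sum_congr rfl fun i _ => ?_
    rw [Fin.sum_univ_succAbove (fun j => f j i) i, add_sub_cancel_left]
  rw [h₁, h₂, Finset.sum_comm]

/-! ### Semidirect products. -/

section Semidirect

variable {L : NLieAlg K k} {M : Type u} [AddCommGroup M] [Module K M]

/-- The action part of the bracket on `L × M`: the sum over `i` of `[l₁, …, mᵢ, …, lₙ]`. -/
noncomputable def actionMap (ρ : L [⋀^Fin (k + 1)]→ₗ[K] Module.End K M) :
    (L × M) [⋀^Fin (k + 2)]→ₗ[K] M :=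
  AlternatingMap.alternatizeUncurryFin
    { toFun := fun p => (-1 : ℤ) ^ (k + 1) • (LinearMap.applyₗ p.2).compAlternatingMap
        (ρ.compLinearMap (LinearMap.fst K L M))
      map_add' := fun p q => by ext; simp
      map_smul' := fun r p => by ext; simp [smul_comm r] }

theorem actionMap_apply (ρ : L [⋀^Fin (k + 1)]→ₗ[K] Module.End K M) (v : Fin (k + 2) → L × M) :
    actionMap ρ v = ∑ i : Fin (k + 2), ((-1 : ℤ) ^ (k + 1) * (-1) ^ (i : ℕ)) •
      ρ (fun j => (v (i.succAbove j)).1) (v i).2 := by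
  rw [actionMap, AlternatingMap.alternatizeUncurryFin_apply]
  refine Finset.sum_congr rfl fun i _ => ?_
  rw [mul_comm, mul_smul]
  rfl

theorem actionMap_cons (ρ : L [⋀^Fin (k + 1)]→ₗ[K] Module.End K M) (p : L × M)
    (y : Fin (k + 1) → L × M) :
    actionMap ρ (Fin.cons p y) = (-1 : ℤ) ^ (k + 1) • ρ (fun j => (y j).1) p.2 +
      ∑ j : Fin (k + 1), ((-1 : ℤ) ^ (k + 1) * (-1) ^ ((j : ℕ) + 1)) •
        ρ (Fin.cons p.1 fun l => (y (j.succAbove l)).1) (y j).2 := by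
  rw [actionMap_apply, Fin.sum_univ_succ]
  congr 1
  · simp
  · refine Finset.sum_congr rfl fun j _ => ?_
    simp only [Fin.val_succ, Fin.cons_succ]
    congr 3
    funext l
    refine Fin.cases ?_ (fun l => ?_) l <;> simp

theorem actionMap_update (ρ : L [⋀^Fin (k + 1)]→ₗ[K] Module.End K M) (x : Fin (k + 2) → L × M)
    (i : Fin (k + 2)) (p : L × M) :
    actionMap ρ (Function.update x i p) =
      ((-1 : ℤ) ^ (k + 1) * (-1) ^ (i : ℕ)) • ρ (fun j => (x (i.succAbove j)).1) p.2 +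
      ∑ j : Fin (k + 1), ((-1 : ℤ) ^ (k + 1) * (-1) ^ ((i.succAbove j : Fin (k + 2)) : ℕ)) •
        ρ (fun l => (Function.update x i p ((i.succAbove j).succAbove l)).1)
          (x (i.succAbove j)).2 := by
  rw [actionMap_apply, Fin.sum_univ_succAbove _ i]
  simp

/-- This is the `M`-component of the fundamental identity of `L × M`. Terms carrying the module
entry of some `y j` match by the second relation of `U(L)`; terms carrying that of some `x i` match
by the first. -/
theorem IsAssocMap.actionMap_fundamental {ρ : L [⋀^Fin (k + 1)]→ₗ[K] Module.End K M}
    (h : IsAssocMap ρ) (x : Fin (k + 2) → L × M) (y : Fin (k + 1) → L × M) :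
    actionMap ρ (Fin.cons (L.bracket fun i => (x i).1, actionMap ρ x) y) =
      ∑ i, actionMap ρ (Function.update x i
        (L.bracket (Fin.cons (x i).1 fun j => (y j).1), actionMap ρ (Fin.cons (x i) y))) := by
  -- Fix the position `i` of the module entry and bracket one of the other entries with `y`: summed
  -- over these entries, this is the commutator relation, with a sign from moving an entry from the
  -- front to the back.
  have hsum : ∀ i : Fin (k + 2), ∑ j : Fin (k + 1),
      ρ (fun l => (Function.update x (i.succAbove j)
        (L.bracket (Fin.cons (x (i.succAbove j)).1 fun j => (y j).1),
          actionMap ρ (Fin.cons (x (i.succAbove j)) y)) (i.succAbove l)).1) =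
      (-1 : ℤ) ^ (k + 1) • (ρ (fun j => (y j).1) * ρ (fun l => (x (i.succAbove l)).1) -
        ρ (fun l => (x (i.succAbove l)).1) * ρ (fun j => (y j).1)) := fun i => by
    rw [h.commutator, Finset.smul_sum]
    refine Finset.sum_congr rfl fun j _ => ?_
    have hu : ∀ p : L × M,
        (fun l => (Function.update x (i.succAbove j) p (i.succAbove l)).1) =
        Function.update (fun l => (x (i.succAbove l)).1) j p.1 := fun p => by
      funext l
      rw [congrFun (Fin.update_succAbove_comp x i j p) l]
      exact Function.apply_update (fun _ => Prod.fst) _ j p l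
    rw [hu, L.bracket.map_cons_eq_snoc]
    simp only [← Int.cast_smul_eq_zsmul K, AlternatingMap.map_update_smul]
  -- The expansion is indexed by the updated position first; exchanging the roles puts the position
  -- of the module entry outside, as `hsum` requires.
  have hswap := Fin.sum_sum_succAbove_comm fun i i' : Fin (k + 2) =>
    ((-1 : ℤ) ^ (k + 1) * (-1) ^ (i' : ℕ)) •
        ρ (fun l => (Function.update x i
          (L.bracket (Fin.cons (x i).1 fun j => (y j).1), actionMap ρ (Fin.cons (x i) y))
            (i'.succAbove l)).1) (x i').2
  simp only [actionMap_update, Finset.sum_add_distrib]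
  rw [hswap, actionMap_cons]
  have h₁ : ∀ i : Fin (k + 2), ∑ j : Fin (k + 1), ((-1 : ℤ) ^ (k + 1) * (-1) ^ (i : ℕ)) •
      ρ (fun l => (Function.update x (i.succAbove j)
        (L.bracket (Fin.cons (x (i.succAbove j)).1 fun j => (y j).1),
          actionMap ρ (Fin.cons (x (i.succAbove j)) y)) (i.succAbove l)).1) (x i).2 =
      ((-1 : ℤ) ^ (k + 1) * (-1) ^ (i : ℕ)) • (-1 : ℤ) ^ (k + 1) •
        (ρ (fun j => (y j).1) (ρ (fun l => (x (i.succAbove l)).1) (x i).2) -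
        ρ (fun l => (x (i.succAbove l)).1) (ρ (fun j => (y j).1) (x i).2)) := fun i => by
    rw [← Finset.smul_sum, ← LinearMap.sum_apply, hsum]
    rfl
  simp only [h₁]
  simp only [actionMap_cons]
  rw [actionMap_apply ρ x]
  have h₂ : ∀ j : Fin (k + 1),
      ρ (Fin.cons (L.bracket fun i => (x i).1) fun l => (y (j.succAbove l)).1) (y j).2 =
        ∑ i : Fin (k + 2), ((-1 : ℤ) ^ (k + 1) * (-1) ^ (i : ℕ)) •
          ρ (fun l => (x (i.succAbove l)).1)
            (ρ (Fin.cons (x i).1 fun l => (y (j.succAbove l)).1) (y j).2) := fun j => by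
    rw [h.bracket, LinearMap.sum_apply]
    refine Finset.sum_congr rfl fun i _ => ?_
    rw [neg_one_pow_sub_eq]
    rfl
  simp only [h₂, map_sum, map_add, smul_add, smul_sub, Finset.smul_sum, Finset.sum_add_distrib,
    Finset.sum_sub_distrib, map_zsmul]
  rw [Finset.sum_comm (s := (Finset.univ : Finset (Fin (k + 2))))
    (t := (Finset.univ : Finset (Fin (k + 1))))]
  simp only [smul_comm ((-1 : ℤ) ^ (k + 1)) (((-1 : ℤ) ^ (k + 1) * _) : ℤ)]
  have h₃ : ∀ (i : Fin (k + 2)) (j : Fin (k + 1)) (m : M),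
      ((-1 : ℤ) ^ (k + 1) * (-1) ^ (i : ℕ)) • ((-1 : ℤ) ^ (k + 1) * (-1) ^ ((j : ℕ) + 1)) • m =
      ((-1 : ℤ) ^ (k + 1) * (-1) ^ ((j : ℕ) + 1)) • ((-1 : ℤ) ^ (k + 1) * (-1) ^ (i : ℕ)) • m :=
    fun i j m => smul_comm _ _ _
  simp only [h₃]
  -- The terms `ρ(x without xᵢ) ρ(y) mᵢ` from the commutators cancel those from updating the module
  -- entry itself.
  abel

/-- The semidirect product `L ⋉ M` of an `n`-Lie algebra and a module over it. -/
noncomputable def semidirect (ρ : L [⋀^Fin (k + 1)]→ₗ[K] Module.End K M) (h : IsAssocMap ρ) :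
    NLieAlg K k where
  carrier := L × M
  bracket := (L.bracket.compLinearMap (LinearMap.fst K L M)).prod (actionMap ρ)
  fundamental x y := by
    have hc : ∀ p : L × M, (fun i => ((Fin.cons p y : Fin (k + 2) → L × M) i).1) =
        Fin.cons p.1 fun i => (y i).1 := fun p => by
      funext i; refine Fin.cases ?_ (fun j => ?_) i <;> simp
    have hu : ∀ (i : Fin (k + 2)) (p : L × M), (fun j => (Function.update x i p j).1) =
        Function.update (fun j => (x j).1) i p.1 := fun i p => by
      funext j
      exact Function.apply_update (fun _ => Prod.fst) x i p j
    apply Prod.ext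
    · simp only [AlternatingMap.prod_apply, AlternatingMap.compLinearMap_apply, Prod.fst_sum]
      change L.bracket (fun i => ((Fin.cons (_, _) y : Fin (k + 2) → L × M) i).1) =
        ∑ i, L.bracket (fun j => (Function.update x i (_, _) j).1)
      simp only [hc, hu]
      refine (L.fundamental _ _).trans (Finset.sum_congr rfl fun i _ => ?_)
      congr 2
      exact congrArg L.bracket (hc _).symm
    · simp only [AlternatingMap.prod_apply, AlternatingMap.compLinearMap_apply, Prod.snd_sum]
      refine (h.actionMap_fundamental x y).trans (Finset.sum_congr rfl fun i _ => ?_)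
      rw [← hc]
      rfl

theorem semidirect_bracket (ρ : L [⋀^Fin (k + 1)]→ₗ[K] Module.End K M) (h : IsAssocMap ρ)
    (v : Fin (k + 2) → L × M) :
    (semidirect ρ h).bracket v = (L.bracket fun i => (v i).1, actionMap ρ v) := rfl

end Semidirect

/-! ### The action on the kernel of a split extension. -/

section SplitExtension

variable {L E : NLieAlg K k} (π : E ⟶ L) (s : L ⟶ E)

theorem map_bracket_snoc (f : L ⟶ E) (x : Fin (k + 1) → L) (y : L) :
    f.lin (L.bracket (Fin.snoc (α := fun _ => L.carrier) x y)) =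
      E.bracket (Fin.snoc (α := fun _ => E.carrier) (fun i => f.lin (x i)) (f.lin y)) := by
  rw [f.map_bracket]
  congr 1
  funext i
  refine Fin.lastCases ?_ (fun j => ?_) i <;> simp

/-- The action of `L` on the kernel of a split extension. -/
noncomputable def kerAction : L [⋀^Fin (k + 1)]→ₗ[K] Module.End K (LinearMap.ker π.lin) where
  toFun x :=
    { toFun := fun m => ⟨(-1 : ℤ) ^ (k + 1) • E.bracket.curryLeft (m : E) fun i => s.lin (x i), by
        rw [LinearMap.mem_ker, map_zsmul, AlternatingMap.curryLeft_apply_apply, π.map_bracket,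
          L.bracket.map_coord_zero 0 (by simp), smul_zero]⟩
      map_add' := fun m m' => Subtype.ext (by simp)
      map_smul' := fun r m => Subtype.ext (by simp [smul_comm r]) }
  map_update_add' x i a b := by
    refine LinearMap.ext fun m => Subtype.ext ?_
    have h : ∀ a, (fun j => s.lin (Function.update x i a j)) =
        Function.update (fun j => s.lin (x j)) i (s.lin a) := fun a =>
      funext fun j => Function.apply_update (fun _ => s.lin) x i a j
    change (-1 : ℤ) ^ (k + 1) • E.bracket.curryLeft (m : E) _ = (-1 : ℤ) ^ (k + 1) •
      E.bracket.curryLeft (m : E) _ + (-1 : ℤ) ^ (k + 1) • E.bracket.curryLeft (m : E) _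
    rw [h, h, h, map_add, AlternatingMap.map_update_add, smul_add]
  map_update_smul' x i r a := by
    refine LinearMap.ext fun m => Subtype.ext ?_
    have h : ∀ a, (fun j => s.lin (Function.update x i a j)) =
        Function.update (fun j => s.lin (x j)) i (s.lin a) := fun a =>
      funext fun j => Function.apply_update (fun _ => s.lin) x i a j
    change (-1 : ℤ) ^ (k + 1) • E.bracket.curryLeft (m : E) _ = r • (-1 : ℤ) ^ (k + 1) •
      E.bracket.curryLeft (m : E) _
    rw [h, h, map_smul, AlternatingMap.map_update_smul, smul_comm]
  map_eq_zero_of_eq' x i j hx hij := by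
    refine LinearMap.ext fun m => Subtype.ext ?_
    have := (E.bracket.curryLeft (m : E)).map_eq_zero_of_eq (fun i => s.lin (x i))
      (congrArg s.lin hx) hij
    change (-1 : ℤ) ^ (k + 1) • E.bracket.curryLeft (m : E) _ = 0
    rw [this, smul_zero]

theorem kerAction_coe (x : Fin (k + 1) → L) (m : LinearMap.ker π.lin) :
    (kerAction π s x m : E) =
      E.bracket (Fin.snoc (α := fun _ => E.carrier) (fun i => s.lin (x i)) (m : E)) := by
  rw [AlternatingMap.map_snoc_eq_cons]
  rfl

/-- Both relations are instances of the fundamental identity in `E`, with the kernel element as last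
entry of the inner tuple for the first relation and of the outer tuple for the second. That `s`
splits `π` plays no role. -/
theorem isAssocMap_kerAction : IsAssocMap (kerAction π s) where
  commutator x y := by
    refine LinearMap.ext fun m => Subtype.ext ?_
    have h := E.fundamental
      (Fin.snoc (α := fun _ => E.carrier) (fun i => s.lin (y i)) (m : E)) (fun i => s.lin (x i))
    -- The last summand, where `m` itself is bracketed, is the product `ρ y * ρ x`; the others form
    -- the right-hand side of the relation.
    rw [Fin.sum_univ_castSucc] at h
    simp only [AlternatingMap.map_cons_eq_snoc, Fin.snoc_castSucc, Fin.snoc_last,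
      ← Int.cast_smul_eq_zsmul K, AlternatingMap.map_update_smul, ← Finset.smul_sum,
      ← smul_add] at h
    have h' := congrArg (fun z => (((-1 : ℤ) ^ (k + 1) : ℤ) : K) • z) h
    simp only [smul_smul, ← Int.cast_mul, ← mul_pow] at h'
    simp only [mul_neg, mul_one, neg_neg, one_pow, Int.cast_one, one_smul] at h'
    simp only [LinearMap.sub_apply, Module.End.mul_apply, Submodule.coe_sub, kerAction_coe,
      LinearMap.sum_apply, Submodule.coe_sum, h', Fin.update_snoc_last, add_sub_cancel_right]
    refine Finset.sum_congr rfl fun i _ => ?_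
    rw [← Fin.snoc_update, ← map_bracket_snoc]
    congr 2
    exact (funext fun j => Function.apply_update (fun _ => s.lin) y i _ j).symm
  bracket x y := by
    refine LinearMap.ext fun m => Subtype.ext ?_
    have h := E.fundamental (fun i => s.lin (x i))
      (Fin.snoc (α := fun _ => E.carrier) (fun i => s.lin (y i)) (m : E))
    have hc : ∀ a, (fun i => s.lin ((Fin.cons a y : Fin (k + 1) → L) i)) =
        Fin.cons (s.lin a) fun i => s.lin (y i) := fun a => by
      funext i; refine Fin.cases ?_ (fun j => ?_) i <;> simp
    rw [← s.map_bracket] at h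
    simp only [LinearMap.sum_apply, Submodule.coe_sum, kerAction_coe, LinearMap.smul_apply,
      Module.End.mul_apply, hc, Fin.cons_snoc_eq_snoc_cons] at h ⊢
    rw [h]
    refine Finset.sum_congr rfl fun i _ => ?_
    rw [AlternatingMap.map_update_eq_cons, AlternatingMap.map_cons_eq_snoc, smul_smul, mul_comm,
      ← neg_one_pow_sub_eq]
    refine Eq.trans ?_ (map_zsmul (LinearMap.ker π.lin).subtype _ _).symm
    rw [Submodule.subtype_apply, kerAction_coe, kerAction_coe, hc]

variable {π s} in
theorem bracket_eq_of_add (hadd : ∀ e e' : Fin (k + 2) → E, (∀ i, π.lin (e i) = π.lin (e' i)) →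
      E.bracket (fun i => e i + e' i - s.lin (π.lin (e i))) =
        E.bracket e + E.bracket e' - E.bracket (fun i => s.lin (π.lin (e i))))
    (x : Fin (k + 2) → L) (m : Fin (k + 2) → LinearMap.ker π.lin)
    (hs : ∀ x, π.lin (s.lin x) = x) :
    E.bracket (fun i => s.lin (x i) + m i) = s.lin (L.bracket x) +
      ∑ i : Fin (k + 2), ((-1 : ℤ) ^ (k + 1) * (-1) ^ (i : ℕ)) •
        (kerAction π s (fun j => x (i.succAbove j)) (m i) : E) := by
  have hm : ∀ i, π.lin (m i) = 0 := fun i => (m i).2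
  -- Kernel parts are switched on one index at a time: the point for `insert a T` is the fibrewise
  -- sum of the point for `T` and the point for `{a}`, so no mixed terms arise.
  have key : ∀ T : Finset (Fin (k + 2)),
      E.bracket (fun i => s.lin (x i) + if i ∈ T then (m i : E) else 0) =
        s.lin (L.bracket x) +
          ∑ i ∈ T, E.bracket (Function.update (fun i => s.lin (x i)) i (m i : E)) := fun T => by
    induction T using Finset.induction_on with
    | empty => simp [s.map_bracket]
    | insert a T ha ih =>
      have h := hadd (fun i => s.lin (x i) + if i ∈ T then (m i : E) else 0)
        (fun i => s.lin (x i) + if i = a then (m i : E) else 0) fun i => by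
          split_ifs <;> simp [hm]
      have h₁ : ∀ i, π.lin (s.lin (x i) + if i ∈ T then (m i : E) else 0) = x i := fun i => by
        split_ifs <;> simp [hm, hs]
      have h₂ : (fun i => s.lin (x i) + if i = a then (m i : E) else 0) =
          Function.update (fun i => s.lin (x i)) a (s.lin (x a) + m a) := by
        funext i
        by_cases hi : i = a
        · subst hi; simp
        · simp [hi]
      simp only [h₁, ih] at h
      rw [h₂, AlternatingMap.map_update_add, Function.update_eq_self, ← s.map_bracket] at h
      rw [Finset.sum_insert ha]
      refine Eq.trans (congrArg E.bracket (funext fun i => ?_)) (h.trans (by abel))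
      by_cases hi : i = a
      · subst hi; simp [ha]
      · simp [hi]
  have h := key Finset.univ
  simp only [Finset.mem_univ, if_true] at h
  rw [h]
  congr 1
  refine Finset.sum_congr rfl fun i _ => ?_
  rw [AlternatingMap.map_update_eq_cons, AlternatingMap.map_cons_eq_snoc, kerAction_coe, smul_smul,
    mul_comm]

end SplitExtension

/-! ### Elements of products in the comma category. -/

section OverProducts

open MonoidalCategory CartesianMonoidalCategory MonObj

variable {L : NLieAlg K k}

theorem tensor_ext {Y Z : Over L} {p q : (Y ⊗ Z).left.carrier}
    (h₁ : (fst Y Z).left.lin p = (fst Y Z).left.lin q)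
    (h₂ : (snd Y Z).left.lin p = (snd Y Z).left.lin q) : p = q :=
  Subtype.ext (Prod.ext h₁ h₂)

/-- The point of the product in `n-Lie ↓ L` with given components. -/
def pair {Y Z : Over L} (y : Y.left.carrier) (z : Z.left.carrier)
    (h : Y.hom.lin y = Z.hom.lin z) : (Y ⊗ Z).left.carrier :=
  (⟨(y, z), h⟩ : fibreSubmodule Y.hom Z.hom)

@[simp]
theorem fst_pair {Y Z : Over L} (y : Y.left.carrier) (z : Z.left.carrier)
    (h : Y.hom.lin y = Z.hom.lin z) : (fst Y Z).left.lin (pair y z h) = y := rfl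

@[simp]
theorem snd_pair {Y Z : Over L} (y : Y.left.carrier) (z : Z.left.carrier)
    (h : Y.hom.lin y = Z.hom.lin z) : (snd Y Z).left.lin (pair y z h) = z := rfl

theorem over_comp_apply {X Y Z : Over L} (f : X ⟶ Y) (g : Y ⟶ Z) (x : X.left.carrier) :
    (f ≫ g).left.lin x = g.left.lin (f.left.lin x) := rfl

theorem over_hom_ext {X Y : Over L} {f g : X ⟶ Y} (h : ∀ x, f.left.lin x = g.left.lin x) : f = g :=
  Over.OverMorphism.ext (hom_ext h)

theorem over_w_apply {X Y : Over L} (f : X ⟶ Y) (x : X.left.carrier) :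
    Y.hom.lin (f.left.lin x) = X.hom.lin x :=
  congrArg (fun φ : X.left ⟶ L => φ.lin x) (Over.w f)

theorem pair_eta {Y Z : Over L} (p : (Y ⊗ Z).left.carrier) :
    ∃ (y : Y.left.carrier) (z : Z.left.carrier) (h : Y.hom.lin y = Z.hom.lin z), p = pair y z h :=
  ⟨_, _, p.2, rfl⟩

theorem tensorHom_pair {Y Y' Z Z' : Over L} (f : Y ⟶ Y') (g : Z ⟶ Z') (y : Y.left.carrier)
    (z : Z.left.carrier) (h : Y.hom.lin y = Z.hom.lin z) :
    (f ⊗ₘ g).left.lin (pair y z h) = pair (f.left.lin y) (g.left.lin z)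
      (by rw [over_w_apply, over_w_apply, h]) := rfl

end OverProducts

/-! ### Group objects as split extensions with additive bracket. -/

section GroupObjects

open MonoidalCategory CartesianMonoidalCategory MonObj

variable {L : NLieAlg K k}

/-- The projection of an object of `n-Lie ↓ L`. -/
abbrev proj (X : Over L) : X.left ⟶ L := X.hom

/-- The section given by the unit of a monoid object. -/
abbrev unitSection (X : Over L) [MonObj X] : L ⟶ X.left := (η[X] : 𝟙_ (Over L) ⟶ X).left

theorem proj_unitSection (X : Over L) [MonObj X] (l : L) :
    (proj X).lin ((unitSection X).lin l) = l :=
  over_w_apply η[X] l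

theorem mul_pair_unit (X : Over L) [MonObj X] (e : X.left.carrier) :
    μ[X].left.lin (pair e ((unitSection X).lin ((proj X).lin e))
      (proj_unitSection X _).symm) = e :=
  congrArg (fun φ : X ⊗ 𝟙_ (Over L) ⟶ X => φ.left.lin (pair e ((proj X).lin e) rfl))
    (MonObj.mul_one X)

theorem mul_unit_pair (X : Over L) [MonObj X] (e : X.left.carrier) :
    μ[X].left.lin (pair ((unitSection X).lin ((proj X).lin e)) e (proj_unitSection X _)) = e :=
  congrArg (fun φ : 𝟙_ (Over L) ⊗ X ⟶ X => φ.left.lin (pair ((proj X).lin e) e rfl))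
    (MonObj.one_mul X)

/-- The multiplication of a monoid object in `n-Lie ↓ L` is determined by its unit. -/
theorem mul_pair (X : Over L) [MonObj X] (e e' : X.left.carrier)
    (h : (proj X).lin e = (proj X).lin e') :
    μ[X].left.lin (pair e e' h) = e + e' - (unitSection X).lin ((proj X).lin e) := by
  -- An Eckmann–Hilton argument: `(e, e') + (s, s) = (e, s) + (s, e')`, and the linear map `μ` is
  -- known by the unit laws on every pair except `(e, e')`.
  have h₁ : pair e e' h + pair ((unitSection X).lin ((proj X).lin e))
      ((unitSection X).lin ((proj X).lin e)) rfl =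
      pair e ((unitSection X).lin ((proj X).lin e)) (proj_unitSection X _).symm +
      pair ((unitSection X).lin ((proj X).lin e')) e' (proj_unitSection X _) := by
    refine tensor_ext ?_ ?_
    · simp only [map_add, fst_pair, h]
    · simp only [map_add, snd_pair, add_comm]
  have h₂ := congrArg μ[X].left.lin h₁
  rw [map_add, map_add, mul_pair_unit, mul_unit_pair] at h₂
  have h₃ := mul_pair_unit X ((unitSection X).lin ((proj X).lin e))
  simp only [proj_unitSection] at h₃
  rw [h₃] at h₂
  rw [eq_sub_iff_add_eq, h₂]

/-- The multiplication preserves brackets, and `mul_pair` makes it explicit. -/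
theorem bracket_add_sub (X : Over L) [MonObj X] (e e' : Fin (k + 2) → X.left.carrier)
    (h : ∀ i, (proj X).lin (e i) = (proj X).lin (e' i)) :
    X.left.bracket (fun i => e i + e' i - (unitSection X).lin ((proj X).lin (e i))) =
      X.left.bracket e + X.left.bracket e' -
        X.left.bracket (fun i => (unitSection X).lin ((proj X).lin (e i))) := by
  have h₁ := μ[X].left.map_bracket fun i => pair (e i) (e' i) (h i)
  have h₂ : (X ⊗ X).left.bracket (fun i => pair (e i) (e' i) (h i)) =
      pair (X.left.bracket e) (X.left.bracket e')
        (by rw [X.hom.map_bracket, X.hom.map_bracket]; exact congrArg _ (funext h)) := rfl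
  simp only [h₂, mul_pair] at h₁
  rw [← h₁, (proj X).map_bracket, (unitSection X).map_bracket]

/-- A morphism in `n-Lie ↓ L` that preserves units preserves multiplications. -/
theorem isMonHom_of_unit {X Y : Over L} [MonObj X] [MonObj Y] (f : X ⟶ Y)
    (h : ∀ l, f.left.lin ((unitSection X).lin l) = (unitSection Y).lin l) : IsMonHom f where
  one_hom := over_hom_ext h
  mul_hom := over_hom_ext fun p => by
    obtain ⟨y, z, hyz, rfl⟩ := pair_eta p
    rw [over_comp_apply, over_comp_apply, tensorHom_pair, mul_pair, mul_pair, map_sub, map_add, h]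
    congr 2
    exact (over_w_apply f y).symm

theorem map_unitSection {X Y : Over L} [MonObj X] [MonObj Y] (f : X ⟶ Y) [IsMonHom f] (l : L) :
    f.left.lin ((unitSection X).lin l) = (unitSection Y).lin l :=
  congrArg (fun φ : 𝟙_ (Over L) ⟶ Y => φ.left.lin l) (IsMonHom.one_hom f)

section OfSection

variable {X : Over L} {s : L ⟶ X.left}

/-- Fibrewise addition is a homomorphism for the bracket. -/
def FibrewiseAdditive (X : Over L) (s : L ⟶ X.left) : Prop :=
  ∀ e e' : Fin (k + 2) → X.left.carrier, (∀ i, (proj X).lin (e i) = (proj X).lin (e' i)) →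
    X.left.bracket (fun i => e i + e' i - s.lin ((proj X).lin (e i))) =
      X.left.bracket e + X.left.bracket e' - X.left.bracket (fun i => s.lin ((proj X).lin (e i)))

/-- Fibrewise addition of a split extension. -/
noncomputable def fibreAdd (hs : ∀ l, (proj X).lin (s.lin l) = l) (hadd : FibrewiseAdditive X s) :
    X ⊗ X ⟶ X :=
  Over.homMk (U := X ⊗ X) (Hom.mk ((fst X X).left.lin + (snd X X).left.lin -
      s.lin ∘ₗ (proj X).lin ∘ₗ (fst X X).left.lin) fun v => by
        have := hadd (fun i => (fst X X).left.lin (v i)) (fun i => (snd X X).left.lin (v i))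
          fun i => (v i).2
        rw [← s.map_bracket, ← (proj X).map_bracket, ← (fst X X).left.map_bracket,
          ← (snd X X).left.map_bracket] at this
        exact this.symm) (hom_ext fun p => by
    obtain ⟨y, z, hyz, rfl⟩ := pair_eta p
    change (proj X).lin (y + z - s.lin ((proj X).lin y)) = (proj X).lin y
    rw [map_sub, map_add, hs, add_sub_cancel_left]
    exact hyz.symm)

/-- Fibrewise negation of a split extension. -/
noncomputable def fibreNeg (hs : ∀ l, (proj X).lin (s.lin l) = l) (hadd : FibrewiseAdditive X s) :
    X ⟶ X :=
  Over.homMk (Hom.mk (s.lin ∘ₗ (proj X).lin + s.lin ∘ₗ (proj X).lin - LinearMap.id) fun v => by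
    -- Additivity is applied to a tuple and its fibrewise negative, whose fibrewise sum is `s(π v)`.
    have := hadd v (fun i => s.lin ((proj X).lin (v i)) + s.lin ((proj X).lin (v i)) - v i)
      fun i => by rw [map_sub, map_add, hs, add_sub_cancel_left]
    have h' : ∀ i, v i + (s.lin ((proj X).lin (v i)) + s.lin ((proj X).lin (v i)) - v i) -
        s.lin ((proj X).lin (v i)) = s.lin ((proj X).lin (v i)) := fun i => by abel
    simp only [h', ← s.map_bracket, ← (proj X).map_bracket] at this
    change s.lin ((proj X).lin (X.left.bracket v)) + s.lin ((proj X).lin (X.left.bracket v)) -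
      X.left.bracket v = X.left.bracket
        (fun i => s.lin ((proj X).lin (v i)) + s.lin ((proj X).lin (v i)) - v i)
    rw [sub_eq_iff_eq_add, ← sub_eq_iff_eq_add.1 this.symm, add_comm]) (hom_ext fun e => by
    change (proj X).lin (s.lin ((proj X).lin e) + s.lin ((proj X).lin e) - e) = (proj X).lin e
    rw [map_sub, map_add, hs, add_sub_cancel_left])

/-- A split extension for which fibrewise addition is a homomorphism is a group object. -/
@[reducible]
noncomputable def grpObjOfSection (hs : ∀ l, (proj X).lin (s.lin l) = l)
    (hadd : FibrewiseAdditive X s) : GrpObj X where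
  one := Over.homMk (U := 𝟙_ (Over L)) s (hom_ext hs)
  mul := fibreAdd hs hadd
  inv := fibreNeg hs hadd
  one_mul := over_hom_ext fun p => by
    obtain ⟨l, e, h, rfl⟩ := pair_eta p
    change s.lin l + e - s.lin ((proj X).lin (s.lin l)) = e
    rw [hs, add_sub_cancel_left]
  mul_one := over_hom_ext fun p => by
    obtain ⟨e, l, h, rfl⟩ := pair_eta p
    change e + s.lin l - s.lin ((proj X).lin e) = e
    rw [show (proj X).lin e = l from h, add_sub_cancel_right]
  mul_assoc := over_hom_ext fun p => by
    obtain ⟨q, c, h, rfl⟩ := pair_eta p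
    obtain ⟨a, b, h', rfl⟩ := pair_eta q
    change a + b - s.lin ((proj X).lin a) + c -
      s.lin ((proj X).lin (a + b - s.lin ((proj X).lin a))) =
      a + (b + c - s.lin ((proj X).lin b)) - s.lin ((proj X).lin a)
    rw [map_sub, map_add, hs, add_sub_cancel_left]
    abel
  left_inv := over_hom_ext fun e => by
    change s.lin ((proj X).lin e) + s.lin ((proj X).lin e) - e + e -
      s.lin ((proj X).lin (s.lin ((proj X).lin e) + s.lin ((proj X).lin e) - e)) =
        s.lin ((proj X).lin e)
    rw [map_sub, map_add, hs, add_sub_cancel_left]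
    abel
  right_inv := over_hom_ext fun e => by
    change e + (s.lin ((proj X).lin e) + s.lin ((proj X).lin e) - e) - s.lin ((proj X).lin e) =
        s.lin ((proj X).lin e)
    abel

/-- The abelian group object given by a split extension. -/
noncomputable def commGrpOfSection (hs : ∀ l, (proj X).lin (s.lin l) = l)
    (hadd : FibrewiseAdditive X s) : LMod L :=
  letI := grpObjOfSection hs hadd
  { X := X
    comm := ⟨over_hom_ext fun p => by
      obtain ⟨y, z, h, rfl⟩ := pair_eta p
      change z + y - s.lin ((proj X).lin z) = y + z - s.lin ((proj X).lin y)
      rw [show (proj X).lin y = (proj X).lin z from h, add_comm]⟩ }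

end OfSection

end GroupObjects

/-! ### Equivalence of abelian group objects with modules over `U(L)`. -/

variable {L : NLieAlg K k}

/-- The scalars that commute with `g` form a subalgebra, so it suffices to test generators. -/
theorem map_smul_of_gen {M N : Type*} [AddCommGroup M] [AddCommGroup N] [Module (AssocAlg L) M]
    [Module (AssocAlg L) N] (g : M →+ N)
    (hK : ∀ (r : K) (m : M),
      g (algebraMap K (AssocAlg L) r • m) = algebraMap K (AssocAlg L) r • g m)
    (hg : ∀ (x : Fin (k + 1) → L) (m : M), g (L.gen x • m) = L.gen x • g m)
    (a : AssocAlg L) (m : M) :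
    g (a • m) = a • g m := by
  let S : Subalgebra K (AssocAlg L) :=
    { carrier := {a | ∀ m, g (a • m) = a • g m}
      mul_mem' := fun {a b} ha hb m => by
        rw [mul_smul, mul_smul, ha, hb]
      add_mem' := fun {a b} ha hb m => by
        rw [add_smul, add_smul, map_add, ha, hb]
      algebraMap_mem' := hK }
  exact mem_of_gen_mem S hg a m

noncomputable instance kerModule (X : Over L) [MonObj X] :
    Module (AssocAlg L) (LinearMap.ker (proj X).lin) :=
  Module.compHom _ (assocLift (kerAction (proj X) (unitSection X))
    (isAssocMap_kerAction _ _)).toRingHom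

theorem gen_smul_ker (X : Over L) [MonObj X] (x : Fin (k + 1) → L)
    (m : LinearMap.ker (proj X).lin) :
    L.gen x • m = kerAction (proj X) (unitSection X) x m :=
  congrArg (fun φ : Module.End K (LinearMap.ker (proj X).lin) => φ m)
    (assocLift_gen _ (isAssocMap_kerAction _ _) x)

theorem algebraMap_smul_ker (X : Over L) [MonObj X] (r : K) (m : LinearMap.ker (proj X).lin) :
    algebraMap K (AssocAlg L) r • m = r • m :=
  congrArg (fun φ : Module.End K (LinearMap.ker (proj X).lin) => φ m)
    ((assocLift _ (isAssocMap_kerAction (proj X) (unitSection X))).commutes r)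

/-- The map of kernels induced by a homomorphism of monoid objects. -/
noncomputable def kerMap {X Y : Over L} [MonObj X] [MonObj Y] (f : X ⟶ Y) [IsMonHom f] :
    LinearMap.ker (proj X).lin →ₗ[AssocAlg L] LinearMap.ker (proj Y).lin :=
  have hf : ∀ m ∈ LinearMap.ker (proj X).lin, f.left.lin m ∈ LinearMap.ker (proj Y).lin :=
    fun m hm => (over_w_apply f m).trans hm
  { toFun := f.left.lin.restrict hf
    map_add' := map_add _
    map_smul' := map_smul_of_gen (f.left.lin.restrict hf).toAddMonoidHom
      (fun r m => by
        rw [algebraMap_smul_ker, algebraMap_smul_ker]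
        exact map_smul (f.left.lin.restrict hf) r m)
      (fun x m => by
        rw [gen_smul_ker, gen_smul_ker]
        refine Subtype.ext ?_
        change f.left.lin (kerAction _ _ x m : X.left.carrier) = _
        rw [kerAction_coe, kerAction_coe, map_bracket_snoc]
        simp only [map_unitSection]
        rfl) }

variable (L) in
/-- The functor taking an abelian group object in `n-Lie ↓ L` to the kernel of its projection. -/
noncomputable def kerFunctor : LMod L ⥤ ModuleCat.{u} (AssocAlg L) where
  obj X := ModuleCat.of (AssocAlg L) (LinearMap.ker (proj X.X).lin)
  map f := ModuleCat.ofHom (kerMap f.hom.hom.hom)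
  map_id _ := rfl
  map_comp _ _ := rfl

/-- The component of an element in the kernel of a split projection. -/
noncomputable def kerPart (X : Over L) [MonObj X] :
    X.left.carrier →ₗ[K] LinearMap.ker (proj X).lin :=
  (LinearMap.id - (unitSection X).lin ∘ₗ (proj X).lin).codRestrict _ fun e => by
    rw [LinearMap.mem_ker]
    change (proj X).lin (e - (unitSection X).lin ((proj X).lin e)) = 0
    rw [map_sub, proj_unitSection, sub_self]

theorem unitSection_add_kerPart (X : Over L) [MonObj X] (e : X.left.carrier) :
    (unitSection X).lin ((proj X).lin e) + (kerPart X e : X.left.carrier) = e :=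
  add_sub_cancel _ _

theorem kerPart_unitSection (X : Over L) [MonObj X] (l : L) :
    kerPart X ((unitSection X).lin l) = 0 := by
  refine Subtype.ext ?_
  change (unitSection X).lin l - (unitSection X).lin ((proj X).lin ((unitSection X).lin l)) = 0
  rw [proj_unitSection, sub_self]

theorem kerPart_coe (X : Over L) [MonObj X] (m : LinearMap.ker (proj X).lin) :
    kerPart X (m : X.left.carrier) = m := by
  refine Subtype.ext ?_
  change (m : X.left.carrier) - (unitSection X).lin ((proj X).lin m) = m
  rw [show (proj X).lin m = 0 from m.2, map_zero, sub_zero]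

theorem bracket_eq_unitSection_add (X : Over L) [MonObj X] (x : Fin (k + 2) → L)
    (m : Fin (k + 2) → LinearMap.ker (proj X).lin) :
    X.left.bracket (fun i => (unitSection X).lin (x i) + m i) = (unitSection X).lin (L.bracket x) +
      ∑ i : Fin (k + 2), ((-1 : ℤ) ^ (k + 1) * (-1) ^ (i : ℕ)) •
        ((L.gen (fun j => x (i.succAbove j)) • m i : LinearMap.ker (proj X).lin) :
          X.left.carrier) := by
  simp only [gen_smul_ker]
  exact bracket_eq_of_add (bracket_add_sub X) x m (proj_unitSection X)

/-- The linear map of split extensions induced by a map of kernels. -/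
noncomputable def extendLin {X Y : Over L} [MonObj X] [MonObj Y]
    (g : LinearMap.ker (proj X).lin →ₗ[AssocAlg L] LinearMap.ker (proj Y).lin) :
    X.left.carrier →ₗ[K] Y.left.carrier :=
  (unitSection Y).lin ∘ₗ (proj X).lin + (LinearMap.ker (proj Y).lin).subtype ∘ₗ
    { toFun := g
      map_add' := map_add g
      map_smul' := fun r m => by
        rw [RingHom.id_apply, ← algebraMap_smul_ker, map_smul, algebraMap_smul_ker] } ∘ₗ kerPart X

theorem extendLin_apply {X Y : Over L} [MonObj X] [MonObj Y]
    (g : LinearMap.ker (proj X).lin →ₗ[AssocAlg L] LinearMap.ker (proj Y).lin)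
    (e : X.left.carrier) : extendLin g e =
      (unitSection Y).lin ((proj X).lin e) + (g (kerPart X e) : Y.left.carrier) := rfl

theorem extendLin_unitSection {X Y : Over L} [MonObj X] [MonObj Y]
    (g : LinearMap.ker (proj X).lin →ₗ[AssocAlg L] LinearMap.ker (proj Y).lin) (l : L) :
    extendLin g ((unitSection X).lin l) = (unitSection Y).lin l := by
  rw [extendLin_apply, proj_unitSection, kerPart_unitSection, map_zero, Submodule.coe_zero,
    add_zero]

theorem extendLin_coe {X Y : Over L} [MonObj X] [MonObj Y]
    (g : LinearMap.ker (proj X).lin →ₗ[AssocAlg L] LinearMap.ker (proj Y).lin)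
    (m : LinearMap.ker (proj X).lin) : extendLin g (m : X.left.carrier) = g m := by
  rw [extendLin_apply, kerPart_coe, show (proj X).lin m = 0 from m.2, map_zero, zero_add]

/-- The morphism of split extensions induced by a map of kernels. -/
noncomputable def extend {X Y : Over L} [MonObj X] [MonObj Y]
    (g : LinearMap.ker (proj X).lin →ₗ[AssocAlg L] LinearMap.ker (proj Y).lin) : X ⟶ Y :=
  Over.homMk (Hom.mk (extendLin g) fun e => by
    have he : e = fun i => (unitSection X).lin ((proj X).lin (e i)) +
        (kerPart X (e i) : X.left.carrier) :=
      funext fun i => (unitSection_add_kerPart X (e i)).symm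
    conv_lhs => rw [he]
    rw [bracket_eq_unitSection_add, map_add, map_sum, extendLin_unitSection]
    simp only [map_zsmul, extendLin_coe, map_smul]
    exact (bracket_eq_unitSection_add Y _ _).symm) (hom_ext fun e => by
    change (proj Y).lin ((unitSection Y).lin ((proj X).lin e) + (g (kerPart X e) : Y.left.carrier)) =
      (proj X).lin e
    rw [map_add, proj_unitSection, show (proj Y).lin (g (kerPart X e)) = 0 from (g _).2, add_zero])

instance : (kerFunctor L).Faithful where
  map_injective {X Y f g} h := by
    refine CommGrp.hom_ext _ _ (over_hom_ext fun e => ?_)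
    have hk : f.hom.hom.hom.left.lin (kerPart X.X e : X.X.left.carrier) =
        g.hom.hom.hom.left.lin (kerPart X.X e : X.X.left.carrier) :=
      congrArg Subtype.val (LinearMap.congr_fun (ModuleCat.hom_ext_iff.1 h) (kerPart X.X e))
    rw [← unitSection_add_kerPart X.X e, map_add, map_add, map_unitSection, map_unitSection, hk]

/-- A kernel map is extended by the identity on the `L`-part. The result respects units, and by
`isMonHom_of_unit` it is then a morphism of group objects. -/
instance : (kerFunctor L).Full where
  map_surjective {X Y} g := by
    have := isMonHom_of_unit (extend (X := X.X) (Y := Y.X) g.hom) (extendLin_unitSection _)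
    refine ⟨InducedCategory.homMk (Grp.homMk (A := X.toGrp) (B := Y.toGrp) (extend g.hom)), ?_⟩
    refine ModuleCat.hom_ext (LinearMap.ext fun m => Subtype.ext ?_)
    exact extendLin_coe g.hom m

section EssSurj

variable {M : Type u} [AddCommGroup M] [Module K M] {ρ : L [⋀^Fin (k + 1)]→ₗ[K] Module.End K M}
  (h : IsAssocMap ρ)

/-- The semidirect product as an object of `n-Lie ↓ L`. -/
noncomputable def semidirectOver : Over L :=
  Over.mk (Y := semidirect ρ h) (Hom.mk (LinearMap.fst K L M) fun _ => rfl)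

variable (ρ) in
theorem actionMap_inl (x : Fin (k + 2) → L) : actionMap ρ (fun i => (x i, 0)) = 0 := by
  rw [actionMap_apply]
  exact Finset.sum_eq_zero fun i _ => by simp

/-- The canonical section of a semidirect product. -/
noncomputable def semidirectSection : L ⟶ (semidirectOver h).left :=
  Hom.mk (L' := semidirect ρ h) (LinearMap.inl K L M) fun x => by
    have : ((L.bracket x, 0) : L × M) = (L.bracket x, actionMap ρ fun i => (x i, 0)) := by
      rw [actionMap_inl]
    exact this

/-- Each summand of `actionMap` is linear in one module entry and otherwise depends only on the
`L`-components, which agree on a fibre. -/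
theorem fibrewiseAdditive_semidirect :
    FibrewiseAdditive (semidirectOver h) (semidirectSection h) := fun e e' hπ => by
  have key : ∀ e e' : Fin (k + 2) → L × M, (∀ i, (e i).1 = (e' i).1) →
      ((L.bracket fun i => (e i + e' i - ((e i).1, (0 : M))).1,
        actionMap ρ fun i => e i + e' i - ((e i).1, (0 : M))) : L × M) =
      (L.bracket fun i => (e i).1, actionMap ρ e) + (L.bracket fun i => (e' i).1, actionMap ρ e') -
        (L.bracket fun i => (e i).1, actionMap ρ fun i => ((e i).1, (0 : M))) := by
    intro e e' hπ
    rw [actionMap_inl]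
    refine Prod.ext ?_ ?_
    · simp [hπ]
    · simp [actionMap_apply, hπ, Finset.sum_add_distrib]
  exact key e e' hπ

theorem kerAction_semidirect (x : Fin (k + 1) → L) (m : M)
    (hm : ((0, m) : L × M) ∈ LinearMap.ker (proj (semidirectOver h)).lin) :
    (kerAction (proj (semidirectOver h)) (semidirectSection h) x ⟨(0, m), hm⟩).1 =
      ((0, ρ x m) : L × M) := by
  refine (kerAction_coe _ _ _ _).trans ?_
  refine (semidirect_bracket ρ h
    (Fin.snoc (α := fun _ => L × M) (fun i => (x i, 0)) (0, m))).trans (Prod.ext ?_ ?_)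
  · exact L.bracket.map_coord_zero (Fin.last _) (by simp)
  · change actionMap ρ _ = _
    rw [actionMap_apply, Fin.sum_univ_castSucc, Finset.sum_eq_zero fun i _ => by simp]
    simp [← mul_pow]

/-- The abelian group object of a semidirect product. -/
noncomputable def semidirectMod : LMod L :=
  commGrpOfSection (s := semidirectSection h) (fun _ => rfl) (fibrewiseAdditive_semidirect h)

theorem unitSection_semidirectMod : unitSection (semidirectMod h).X = semidirectSection h := rfl

/-- The inclusion of the module into the kernel of the projection of a semidirect product. -/
noncomputable def semidirectIncl : M →ₗ[K] LinearMap.ker (proj (semidirectMod h).X).lin :=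
  (LinearMap.inr K L M).codRestrict (LinearMap.ker (LinearMap.fst K L M)) fun _ => rfl

theorem semidirectIncl_bijective : Function.Bijective (semidirectIncl h) := by
  constructor
  · intro m m' hm
    exact congrArg (fun p : LinearMap.ker (LinearMap.fst K L M) => p.1.2) hm
  · rintro ⟨⟨l, m⟩, hl⟩
    replace hl : l = 0 := hl
    subst hl
    exact ⟨m, rfl⟩

theorem semidirectIncl_action (x : Fin (k + 1) → L) (m : M) :
    semidirectIncl h (ρ x m) = L.gen x • semidirectIncl h m := by
  rw [gen_smul_ker, unitSection_semidirectMod]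
  exact Subtype.ext (kerAction_semidirect h x m rfl).symm

end EssSurj

/-- The inclusion of a module over the associated algebra into the semidirect product. -/
noncomputable def semidirectEquiv {M : Type u} [AddCommGroup M] [Module K M] [Module (AssocAlg L) M]
    [IsScalarTower K (AssocAlg L) M]
    (h : IsAssocMap ((Algebra.lsmul K K M : AssocAlg L →ₐ[K] _).toLinearMap.compAlternatingMap
      (genMap L))) :
    M ≃ₗ[AssocAlg L] LinearMap.ker (proj (semidirectMod h).X).lin :=
  LinearEquiv.ofBijective
    { toFun := semidirectIncl h
      map_add' := map_add _
      map_smul' := map_smul_of_gen (semidirectIncl h).toAddMonoidHom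
        (fun r m => by
          refine (congrArg (semidirectIncl h) (algebraMap_smul (AssocAlg L) r m)).trans ?_
          exact (map_smul (semidirectIncl h) r m).trans (algebraMap_smul_ker _ r _).symm)
        (semidirectIncl_action h) }
    (semidirectIncl_bijective h)

instance : (kerFunctor L).EssSurj where
  mem_essImage M := by
    let _ : Module K M := Module.restrictScalars K (AssocAlg L) M
    have _ : IsScalarTower K (AssocAlg L) M := IsScalarTower.restrictScalars K (AssocAlg L) M
    have h := (isAssocMap_genMap (L := L)).comp (Algebra.lsmul K K M)
    exact ⟨semidirectMod h, ⟨(LinearEquiv.toModuleIso (semidirectEquiv h)).symm⟩⟩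

theorem nonempty_equivalence (L : NLieAlg K k) :
    Nonempty (LMod L ≌ ModuleCat.{u} (AssocAlg L)) :=
  have : (kerFunctor L).IsEquivalence := {}
  ⟨(kerFunctor L).asEquivalence⟩

end NLieAlg

/-! ### Rings Morita equivalent to commutative rings. -/

theorem ModuleCat.isSeparator_self (R : Type u) [Ring R] : IsSeparator (ModuleCat.of.{u} R R) := by
  rw [isSeparator_def]
  intro X Y f g h
  ext x
  have := congrArg (fun φ => φ.hom (1 : R)) (h (ModuleCat.ofHom (LinearMap.toSpanSingleton R X x)))
  simpa using this

theorem ModuleCat.comp_comm_self (R : Type u) [Ring R] (hR : ∀ a b : R, a * b = b * a)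
    (f g : ModuleCat.of.{u} R R ⟶ ModuleCat.of.{u} R R) : f ≫ g = g ≫ f := by
  have hf : ∀ (φ : R →ₗ[R] R) r, φ r = r * φ 1 := fun φ r => by
    rw [← smul_eq_mul, ← map_smul, smul_eq_mul, mul_one]
  refine ModuleCat.hom_ext (LinearMap.ext fun r => ?_)
  change g.hom (f.hom r) = f.hom (g.hom r)
  rw [hf g.hom, hf f.hom, hf f.hom (g.hom r), hf g.hom r, mul_assoc, mul_assoc, hR (f.hom 1)]

section CommutativeGenerator

variable {S : Type u} [Ring S] {Q : ModuleCat.{u} S}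

/-- This replaces element arguments by tests on images of maps from the generator: the quotient map
by `T` vanishes on all of them, hence is zero. -/
theorem CategoryTheory.IsSeparator.submodule_eq_top (hQ : IsSeparator Q) {N : Type u}
    [AddCommGroup N] [Module S N] (T : Submodule S N) (hT : ∀ (f : Q →ₗ[S] N) (q : Q), f q ∈ T) :
    T = ⊤ := by
  have h : ModuleCat.ofHom T.mkQ = ModuleCat.ofHom 0 := by
    refine (isSeparator_def Q).1 hQ _ _ fun f => ?_
    ext q
    simpa using hT f.hom q
  have h' : T.mkQ = 0 := congrArg ModuleCat.Hom.hom h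
  rw [← T.ker_mkQ, h', LinearMap.ker_zero]

/-- If the category of `S`-modules has a generator with commutative endomorphism ring, then the
annihilators of a submodule and of its quotient commute. -/
theorem CategoryTheory.IsSeparator.smul_smul_eq_zero (hQ : IsSeparator Q)
    (hc : ∀ f g : Q →ₗ[S] Q, f ∘ₗ g = g ∘ₗ f) {V : Type u} [AddCommGroup V] [Module S V]
    (W : Submodule S V) {a b : S} (ha : ∀ v : V, a • v ∈ W) (hb : ∀ w ∈ W, b • w = 0) (v : V) :
    a • b • v = 0 := by
  -- With `I` the annihilator of `V/W` and `J` that of `W`, these are `IQ` and `JQ`. Commuting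
  -- endomorphisms of `Q` turn the trivial `J I V = 0` into `I J V = 0`.
  let IQ : Submodule S Q :=
    Submodule.span S {x | ∃ (i : S) (q : Q), (∀ v : V, i • v ∈ W) ∧ i • q = x}
  let JQ : Submodule S Q :=
    Submodule.span S {x | ∃ (j : S) (q : Q), (∀ w ∈ W, j • w = 0) ∧ j • q = x}
  have hIQ : ∀ (f : Q →ₗ[S] V), ∀ x ∈ IQ, f x ∈ W := fun f x hx => by
    have hle : IQ ≤ W.comap f := Submodule.span_le.2 (by
      rintro _ ⟨i, q, hi, rfl⟩
      change f (i • q) ∈ W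
      rw [map_smul]
      exact hi _)
    exact hle hx
  have h₁ : ∀ (f : Q →ₗ[S] V) (h : Q →ₗ[S] Q), (∀ q, h q ∈ IQ) → ∀ x ∈ JQ, f (h x) = 0 :=
    fun f h hh x hx => by
      have hle : JQ ≤ LinearMap.ker (f ∘ₗ h) := Submodule.span_le.2 (by
        rintro _ ⟨j, q, hj, rfl⟩
        change f (h (j • q)) = 0
        rw [map_smul, map_smul]
        exact hj _ (hIQ f _ (hh q)))
      exact hle hx
  have h₂ : ∀ (f : Q →ₗ[S] V) (g : Q →ₗ[S] Q), (∀ q, g q ∈ JQ) → ∀ x ∈ IQ, f (g x) = 0 :=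
    fun f g hg x hx => by
      have := hQ.submodule_eq_top (LinearMap.ker (f ∘ₗ g ∘ₗ IQ.subtype)) fun h q => by
        change f ((g ∘ₗ (IQ.subtype ∘ₗ h)) q) = 0
        -- Commuting `g`, with image in `JQ`, past an endomorphism with image in `IQ` reduces to
        -- `h₁`.
        rw [hc]
        exact h₁ f (IQ.subtype ∘ₗ h) (fun q => (h q).2) _ (hg q)
      have hx' : (⟨x, hx⟩ : IQ) ∈ LinearMap.ker (f ∘ₗ g ∘ₗ IQ.subtype) := this ▸ trivial
      exact hx'
  have h₃ : ∀ (f : Q →ₗ[S] V), ∀ x ∈ JQ, ∀ i : S, (∀ v : V, i • v ∈ W) → i • f x = 0 :=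
    fun f x hx => by
      let T : Submodule S JQ :=
        { carrier := {x | ∀ i : S, (∀ v : V, i • v ∈ W) → i • f x = 0}
          zero_mem' := fun i _ => by simp
          add_mem' := fun {x y} hx hy i hi => by
            rw [Submodule.coe_add, map_add, smul_add, hx i hi, hy i hi, add_zero]
          smul_mem' := fun r x hx i hi => by
            -- Here `I` must be a two-sided ideal: `i * r` again maps `V` into `W`.
            rw [Submodule.coe_smul, map_smul, smul_smul]
            exact hx (i * r) fun v => by rw [mul_smul]; exact hi _ }
      have := hQ.submodule_eq_top T fun g q i hi => by
        have := h₂ f (JQ.subtype ∘ₗ g) (fun q => (g q).2) (i • q)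
          (Submodule.subset_span ⟨i, q, hi, rfl⟩)
        rwa [map_smul, map_smul] at this
      have hx' : (⟨x, hx⟩ : JQ) ∈ T := this ▸ trivial
      exact hx'
  let T : Submodule S V :=
    { carrier := {v | ∀ b : S, (∀ w ∈ W, b • w = 0) → a • b • v = 0}
      zero_mem' := fun i _ => by simp
      add_mem' := fun {x y} hx hy i hi => by
        rw [smul_add, smul_add, hx i hi, hy i hi, add_zero]
      smul_mem' := fun r x hx i hi => by
        rw [smul_smul i]
        exact hx (i * r) fun w hw => by rw [mul_smul]; exact hi _ (W.smul_mem r hw) }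
  have hT := hQ.submodule_eq_top T fun f q b hb => by
    rw [← map_smul]
    exact h₃ f _ (Submodule.subset_span ⟨b, q, hb, rfl⟩) a ha
  have hv : v ∈ T := hT ▸ trivial
  exact hv b hb

/-- Over a ring Morita equivalent to a commutative one, the annihilators of a submodule and of its
quotient commute. -/
theorem smul_smul_eq_zero_of_equivalence {R : Type u} [Ring R] (hR : ∀ a b : R, a * b = b * a)
    (e : ModuleCat.{u} R ≌ ModuleCat.{u} S) {V : Type u} [AddCommGroup V] [Module S V]
    (W : Submodule S V) {a b : S} (ha : ∀ v : V, a • v ∈ W) (hb : ∀ w ∈ W, b • w = 0) (v : V) :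
    a • b • v = 0 := by
  refine ((ModuleCat.isSeparator_self R).of_equivalence e).smul_smul_eq_zero
    (fun f g => ?_) W ha hb v
  obtain ⟨f', hf⟩ := e.functor.map_surjective (ModuleCat.ofHom f)
  obtain ⟨g', hg⟩ := e.functor.map_surjective (ModuleCat.ofHom g)
  have := congrArg e.functor.map (ModuleCat.comp_comm_self R hR g' f')
  rw [e.functor.map_comp, e.functor.map_comp, hf, hg] at this
  exact congrArg ModuleCat.Hom.hom this

end CommutativeGenerator

namespace NLieAlg

variable {K : Type u} [CommRing K] {k : ℕ}

theorem _root_.AlternatingMap.map_snoc_succAbove {R M N : Type*} [CommRing R] [AddCommGroup M]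
    [AddCommGroup N] [Module R M] [Module R N] {n : ℕ} (f : M [⋀^Fin (n + 1)]→ₗ[R] N)
    (z : Fin (n + 1) → M) (i : Fin (n + 1)) :
    f (Fin.snoc (α := fun _ => M) (fun j => z (i.succAbove j)) (z i)) =
      ((-1 : ℤ) ^ n * (-1) ^ (i : ℕ)) • f z := by
  conv_rhs => rw [← Function.update_eq_self i z, f.map_update_eq_cons, smul_smul, mul_assoc,
    ← mul_pow]
  rw [f.map_snoc_eq_cons]
  simp

section MoritaCommutative

variable {S : Type u} [Ring S] [Algebra K S] {V : Type u} [AddCommGroup V] [Module K V]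

/-- The criterion for a representation on a `K`-module; it avoids carrying an `S`-module structure
on `V`. -/
theorem _root_.AlgHom.apply_apply_eq_zero_of_equivalence {R : Type u} [Ring R]
    (hR : ∀ a b : R, a * b = b * a) (e : ModuleCat.{u} R ≌ ModuleCat.{u} S)
    (φ : S →ₐ[K] Module.End K V) (W : Submodule K V) (hW : ∀ (s : S), ∀ w ∈ W, φ s w ∈ W) {a b : S}
    (ha : ∀ v : V, φ a v ∈ W) (hb : ∀ w ∈ W, φ b w = 0) (v : V) : φ a (φ b v) = 0 := by
  let _ : Module S V := Module.compHom V φ.toRingHom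
  let W' : Submodule S V := { W with smul_mem' := fun s w hw => hW s w hw }
  exact smul_smul_eq_zero_of_equivalence hR e W' ha hb v

theorem apply_apply_eq_zero_of_equivalence {L : NLieAlg K k} {R : Type u} [Ring R]
    (hR : ∀ a b : R, a * b = b * a) (e : ModuleCat.{u} R ≌ ModuleCat.{u} (AssocAlg L))
    {ρ : L [⋀^Fin (k + 1)]→ₗ[K] Module.End K V} (h : IsAssocMap ρ) (W : Submodule K V)
    (hW : ∀ x, ∀ w ∈ W, ρ x w ∈ W) {x y : Fin (k + 1) → L} (hx : ∀ v : V, ρ x v ∈ W)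
    (hy : ∀ w ∈ W, ρ y w = 0) (v : V) : ρ x (ρ y v) = 0 := by
  let T : Subalgebra K (AssocAlg L) :=
    { carrier := {a | ∀ w ∈ W, assocLift ρ h a w ∈ W}
      mul_mem' := fun {a b} ha hb w hw => by
        rw [map_mul]
        exact ha _ (hb _ hw)
      add_mem' := fun {a b} ha hb w hw => by
        rw [map_add]
        exact W.add_mem (ha _ hw) (hb _ hw)
      algebraMap_mem' := fun r w hw => by
        rw [AlgHom.commutes]
        exact W.smul_mem r hw }
  have hT : ∀ a, a ∈ T := mem_of_gen_mem T fun x w hw => by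
    rw [assocLift_gen]
    exact hW x w hw
  have := AlgHom.apply_apply_eq_zero_of_equivalence hR e (assocLift ρ h) W hT (a := L.gen x)
    (b := L.gen y) (by simpa only [assocLift_gen] using hx)
    (by simpa only [assocLift_gen] using hy) v
  simpa only [assocLift_gen] using this

end MoritaCommutative

/-- The zero homomorphism. -/
def zeroHom (L L' : NLieAlg K k) : L ⟶ L' :=
  Hom.mk 0 fun _ => (L'.bracket.map_coord_zero 0 rfl).symm

/-! ### An algebra whose modules are not those of a commutative ring. -/

section DetAlg

open Matrix in
theorem _root_.Matrix.sum_detRowAlternating_update_smul {n : ℕ} (x : Fin n → Fin n → K)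
    (b : Fin n → K) :
    ∑ i, (detRowAlternating : (Fin n → K) [⋀^Fin n]→ₗ[K] K) (Function.update x i b) • x i =
      (detRowAlternating : (Fin n → K) [⋀^Fin n]→ₗ[K] K) x • b := by
  have h := mulVec_cramer (of x)ᵀ b
  rw [det_transpose] at h
  refine Eq.trans ?_ h
  funext l
  simp only [Finset.sum_apply, Pi.smul_apply, smul_eq_mul, mulVec, dotProduct, transpose_apply,
    cramer_transpose_apply]
  exact Finset.sum_congr rfl fun i _ => mul_comm _ _

variable (K k) in
/-- The `n`-Lie algebra `Kⁿ` with bracket `det(v₁, …, vₙ) e₀`. -/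
noncomputable def detAlg : NLieAlg K k where
  carrier := Fin (k + 2) → K
  bracket := (LinearMap.toSpanSingleton K (Fin (k + 2) → K) (Pi.single 0 1)).compAlternatingMap
    Matrix.detRowAlternating
  fundamental x y := by
    let D : (Fin (k + 2) → K) [⋀^Fin (k + 2)]→ₗ[K] K := Matrix.detRowAlternating
    let e : Fin (k + 2) → K := Pi.single 0 1
    change D (Fin.cons (D x • e) y) • e =
      ∑ i, D (Function.update x i (D (Fin.cons (x i) y) • e)) • e
    rw [← Finset.sum_smul]
    congr 1
    -- The identity is Cramer's rule for `e` in terms of the rows `x i`, with the linear functional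
    -- `z ↦ D(z, y)` applied to it.
    have h : ∀ z, D (Fin.cons z y) = (D.curryLeft z) y := fun z => rfl
    rw [h, ← Matrix.sum_detRowAlternating_update_smul, map_sum]
    refine (map_sum (AddMonoidHom.mk' (fun f : (Fin (k + 2) → K) [⋀^Fin (k + 1)]→ₗ[K] K => f y)
      fun _ _ => rfl) _ _).trans ?_
    refine Finset.sum_congr rfl fun i _ => ?_
    rw [AlternatingMap.map_update_smul, map_smul, smul_eq_mul, mul_comm]
    rfl

theorem detAlg_bracket (v : Fin (k + 2) → Fin (k + 2) → K) :
    (detAlg K k).bracket v = Matrix.det (Matrix.of v) • (Pi.single 0 1 : Fin (k + 2) → K) := rfl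

variable (K) in
/-- The standard basis of `detAlg`. -/
def detBasis (i : Fin (k + 2)) : detAlg K k := (Pi.single i 1 : Fin (k + 2) → K)

theorem detAlg_bracket_detBasis : (detAlg K k).bracket (detBasis K) = detBasis K 0 := by
  refine (detAlg_bracket _).trans ?_
  have : Matrix.of (fun j => (Pi.single j 1 : Fin (k + 2) → K)) = 1 := by
    ext a b
    simp [Matrix.one_apply, Pi.single_apply, eq_comm]
  exact (congrArg (fun A => Matrix.det A • (Pi.single 0 1 : Fin (k + 2) → K)) this).trans
    (by simp [detBasis])

theorem detBasis_ne_zero [Nontrivial K] (i : Fin (k + 2)) : detBasis K i ≠ 0 := fun h => by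
  have h' : (Pi.single i 1 : Fin (k + 2) → K) = 0 := h
  simpa using congrFun h' i

/-- The category of modules over the associated algebra of `detAlg` is not the category of modules
over a commutative ring. -/
theorem isEmpty_equivalence_detAlg [Nontrivial K] {R : Type u} [Ring R]
    (hR : ∀ a b : R, a * b = b * a) :
    IsEmpty (ModuleCat.{u} R ≌ ModuleCat.{u} (AssocAlg (detAlg K k))) := by
  refine ⟨fun e => ?_⟩
  -- With zero projection the kernel is the whole algebra, and with `s` the identity `kerAction` is
  -- the adjoint action.
  let π := zeroHom (detAlg K k) (detAlg K k)
  let W : Submodule K (LinearMap.ker π.lin) :=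
    (Submodule.span K {detBasis K 0}).comap (LinearMap.ker π.lin).subtype
  have hmem : ∀ v, (detAlg K k).bracket v ∈ Submodule.span K {detBasis K (k := k) 0} := fun v =>
    Submodule.mem_span_singleton.2 ⟨_, (detAlg_bracket v).symm⟩
  have hρ : ∀ x v, kerAction π (𝟙 _) x v ∈ W := fun x v => by
    change (kerAction π (𝟙 _) x v : detAlg K k) ∈ Submodule.span K {detBasis K 0}
    rw [kerAction_coe]
    exact hmem _
  have hbasis : ∀ i, kerAction π (𝟙 _) (fun j => detBasis K (i.succAbove j)) ⟨detBasis K i, rfl⟩ =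
      ((-1 : ℤ) ^ (k + 1) * (-1) ^ (i : ℕ)) • (⟨detBasis K 0, rfl⟩ : LinearMap.ker π.lin) :=
    fun i => by
      refine Subtype.ext ((kerAction_coe _ _ _ _).trans ?_)
      exact ((detAlg K k).bracket.map_snoc_succAbove _ i).trans (by rw [detAlg_bracket_detBasis])
  have hzero : ∀ w ∈ W,
      kerAction π (𝟙 _) (fun j => detBasis K ((1 : Fin (k + 2)).succAbove j)) w = 0 := by
    intro w hw
    obtain ⟨r, hr⟩ := Submodule.mem_span_singleton.1 hw
    have hw' : w = r • (⟨detBasis K 0, rfl⟩ : LinearMap.ker π.lin) := Subtype.ext hr.symm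
    rw [hw', map_smul]
    refine (congrArg (r • ·) (Subtype.ext ((kerAction_coe _ _ _ _).trans ?_))).trans (smul_zero r)
    refine (detAlg K k).bracket.map_eq_zero_of_eq _ (i := 0) (j := Fin.last _) ?_
      (by simp [Fin.ext_iff])
    rw [← Fin.castSucc_zero, Fin.snoc_castSucc, Fin.snoc_last]
    simp
  -- The tuple omitting `e₀` sends `e₀` to `±e₀`; the tuple omitting `e₁` contains `e₀`, so it kills
  -- `W`, and it sends `e₁` to `±e₀`. Their composite sends `e₁` to `±e₀`, which is not zero.
  have h := apply_apply_eq_zero_of_equivalence hR e (isAssocMap_kerAction π (𝟙 _)) W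
    (fun x w _ => hρ x w) (hρ (fun j => detBasis K ((0 : Fin (k + 2)).succAbove j))) hzero
    ⟨detBasis K 1, rfl⟩
  rw [hbasis, map_zsmul, hbasis, smul_smul, ← pow_add, ← pow_add, ← pow_add] at h
  have h' := congrArg Subtype.val h
  rcases neg_one_pow_eq_or ℤ (k + 1 + ((1 : Fin (k + 2)) : ℕ) + (k + 1 + ((0 : Fin (k + 2)) : ℕ)))
    with h₁ | h₁
  · rw [h₁, one_smul] at h'
    exact detBasis_ne_zero 0 h'
  · rw [h₁, neg_smul, one_smul] at h'
    exact detBasis_ne_zero 0 (neg_eq_zero.1 h')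

end DetAlg

end NLieAlg

/-! ### Augmentation ideals with zero tensor square. -/

section AugmentedAlgebra

open TensorProduct

variable {K A : Type u} [CommRing K] [Ring A] [Algebra K A] (ε : A →ₐ[K] K)

/-- The algebra homomorphism acting through `l` on the image of the idempotent `P` and through the
augmentation `ε` on its complement. -/
def AlgHom.glue {E : Type*} [Ring E] [Algebra K E] (l : A →ₐ[K] E) (P : E) (hP : P * P = P)
    (hl : ∀ a, P * l a = l a * P) : A →ₐ[K] E :=
  AlgHom.ofLinearMap (LinearMap.mulLeft K P ∘ₗ l.toLinearMap +
      (LinearMap.toSpanSingleton K E (1 - P)) ∘ₗ ε.toLinearMap)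
    (by simp)
    (fun a b => by
      have h₁ : P * l a * (P * l b) = P * l (a * b) := by
        rw [mul_assoc, ← mul_assoc (l a), ← hl a, mul_assoc, ← mul_assoc, hP, map_mul]
      have h₂ : P * l a * (1 - P) = 0 := by
        rw [hl a, mul_assoc, mul_sub, hP, mul_one, sub_self, mul_zero]
      have h₃ : (1 - P) * (P * l b) = 0 := by
        rw [← mul_assoc, sub_mul, hP, one_mul, sub_self, zero_mul]
      have h₄ : (1 - P) * (1 - P) = 1 - P := by
        rw [mul_sub, mul_one, sub_mul, one_mul, hP, sub_self, sub_zero]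
      change P * l (a * b) + ε (a * b) • (1 - P) =
        (P * l a + ε a • (1 - P)) * (P * l b + ε b • (1 - P))
      simp only [add_mul, mul_add, h₁, h₂, h₃, h₄, smul_mul_assoc, mul_smul_comm, smul_zero,
        smul_smul, map_mul, add_zero, zero_add, mul_comm (ε b)])

theorem AlgHom.glue_apply {E : Type*} [Ring E] [Algebra K E] (l : A →ₐ[K] E) (P : E)
    (hP : P * P = P) (hl : ∀ a, P * l a = l a * P) (a : A) :
    AlgHom.glue ε l P hP hl a = P * l a + ε a • (1 - P) := rfl

/-- If any two homomorphisms from `A` extend to `S` along `i₁` and `i₂`, where `S` is Morita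
equivalent to a commutative ring, then the augmentation ideal of `A` has zero tensor square. -/
theorem tmul_eq_zero_of_equivalence {R S : Type u} [Ring R] [Ring S] [Algebra K S]
    (hR : ∀ a b : R, a * b = b * a) (e : ModuleCat.{u} R ≌ ModuleCat.{u} S) (i₁ i₂ : A →ₐ[K] S)
    (hS : ∀ (T : Type u) [Ring T] [Algebra K T] (f g : A →ₐ[K] T),
      ∃ φ : S →ₐ[K] T, φ.comp i₁ = f ∧ φ.comp i₂ = g)
    {a b : A} (ha : ε a = 0) (hb : ε b = 0) : a ⊗ₜ[K] b = 0 := by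
  let W : Submodule K (A ⊗[K] A) := LinearMap.ker (ε.toLinearMap.rTensor A)
  -- `P` is the projection `x ⊗ y ↦ ε(x) 1 ⊗ y`, which vanishes on `W`.
  let P : Module.End K (A ⊗[K] A) := ((Algebra.ofId K A).toLinearMap ∘ₗ ε.toLinearMap).rTensor A
  let T : Subalgebra K (Module.End K (A ⊗[K] A)) :=
    { carrier := {f | ∀ w ∈ W, f w ∈ W}
      mul_mem' := fun {f g} hf hg w hw => hf _ (hg _ hw)
      add_mem' := fun {f g} hf hg w hw => W.add_mem (hf _ hw) (hg _ hw)
      algebraMap_mem' := fun r w hw => W.smul_mem r hw }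
  let α : A →ₐ[K] Module.End K (A ⊗[K] A) :=
    (Module.End.rTensorAlgHom K A A).comp (Algebra.lmul K A)
  let l : A →ₐ[K] Module.End K (A ⊗[K] A) :=
    (Module.End.lTensorAlgHom K A A).comp (Algebra.lmul K A)
  have hαt : ∀ a x y : A, α a (x ⊗ₜ y) = (a * x) ⊗ₜ y := fun _ _ _ => rfl
  have hlt : ∀ a x y : A, l a (x ⊗ₜ y) = x ⊗ₜ (a * y) := fun _ _ _ => rfl
  have hPt : ∀ x y : A, P (x ⊗ₜ y) = (algebraMap K A (ε x)) ⊗ₜ y := fun _ _ => rfl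
  have hα : ∀ a v, ε.toLinearMap.rTensor A (α a v) = ε a • ε.toLinearMap.rTensor A v :=
    fun a v => by
      induction v with
      | zero => simp
      | tmul x y => simp [hαt, TensorProduct.smul_tmul']
      | add x y hx hy => rw [map_add, map_add, map_add, smul_add, hx, hy]
  have hPP : P * P = P := by
    ext x y
    simp [hPt]
  have hPl : ∀ a, P * l a = l a * P := fun a => by
    ext x y
    simp [hPt, hlt]
  have hPW : ∀ w ∈ W, P w = 0 := fun w hw => by
    change ((Algebra.ofId K A).toLinearMap ∘ₗ ε.toLinearMap).rTensor A w = 0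
    rw [LinearMap.rTensor_comp, LinearMap.comp_apply, show ε.toLinearMap.rTensor A w = 0 from hw,
      map_zero]
  -- `β` acts on `1 ⊗ A` by multiplication on the second factor, and on `W` through `ε`; so elements
  -- of the augmentation ideal kill `W`.
  let β : A →ₐ[K] Module.End K (A ⊗[K] A) := AlgHom.glue ε l P hPP hPl
  have hβ : ∀ b, ∀ w ∈ W, β b w = ε b • w := fun b w hw => by
    change (P * l b) w + ε b • (w - P w) = ε b • w
    rw [hPl, Module.End.mul_apply, hPW w hw, map_zero, zero_add, sub_zero]
  let α' : A →ₐ[K] T := α.codRestrict T fun a w hw => by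
    change ε.toLinearMap.rTensor A (α a w) = 0
    rw [hα, show ε.toLinearMap.rTensor A w = 0 from hw, smul_zero]
  let β' : A →ₐ[K] T := β.codRestrict T fun b w hw => by
    rw [hβ b w hw]
    exact W.smul_mem _ hw
  -- Extending into `T` rather than into all endomorphisms ensures that all of `S` preserves `W`;
  -- `S` is not assumed to be generated by the images of `i₁` and `i₂`.
  obtain ⟨φ, h₁, h₂⟩ := hS T α' β'
  have h₁' : ∀ a, (T.val.comp φ) (i₁ a) = α a := fun a =>
    congrArg (fun f : A →ₐ[K] T => (f a : Module.End K (A ⊗[K] A))) h₁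
  have h₂' : ∀ a, (T.val.comp φ) (i₂ a) = β a := fun a =>
    congrArg (fun f : A →ₐ[K] T => (f a : Module.End K (A ⊗[K] A))) h₂
  have h := AlgHom.apply_apply_eq_zero_of_equivalence hR e (T.val.comp φ) W
    (fun s w hw => (φ s).2 w hw) (a := i₁ a) (b := i₂ b)
    (fun v => by
      rw [h₁']
      change ε.toLinearMap.rTensor A (α a v) = 0
      rw [hα, ha, zero_smul])
    (fun w hw => by rw [h₂', hβ b w hw, hb, zero_smul]) (1 ⊗ₜ 1)
  rw [h₁', h₂'] at h
  have hβb : β b (1 ⊗ₜ 1) = 1 ⊗ₜ b := by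
    change AlgHom.glue ε l P hPP hPl b (1 ⊗ₜ 1) = 1 ⊗ₜ b
    rw [AlgHom.glue_apply, hb, zero_smul, add_zero, Module.End.mul_apply, hlt, hPt, map_one,
      map_one, mul_one]
  rwa [hβb, hαt, mul_one] at h

/-- If the augmentation ideal of `A` has zero tensor square, then any two homomorphisms from `A`
have commuting images. -/
theorem AlgHom.commute_of_tmul_eq_zero
    (h : ∀ a b : A, ε a = 0 → ε b = 0 → a ⊗ₜ[K] b = 0) {B : Type*} [Ring B] [Algebra K B]
    (f g : A →ₐ[K] B) (a b : A) : f a * g b = g b * f a := by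
  have h₀ : ∀ (f g : A →ₐ[K] B) (a b : A), ε a = 0 → ε b = 0 → f a * g b = 0 :=
    fun f g a b ha hb => by
      have := congrArg (TensorProduct.lift ((LinearMap.mul K B).compl₁₂ f.toLinearMap g.toLinearMap))
        (h a b ha hb)
      simpa using this
  have hε : ∀ a, ε (a - algebraMap K A (ε a)) = 0 := fun a => by simp
  have hfa : f a = f (a - algebraMap K A (ε a)) + algebraMap K B (ε a) := by simp
  have hgb : g b = g (b - algebraMap K A (ε b)) + algebraMap K B (ε b) := by simp
  rw [hfa, hgb]
  simp only [add_mul, mul_add, h₀ f g _ _ (hε a) (hε b), h₀ g f _ _ (hε b) (hε a)]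
  rw [Algebra.commutes (ε a) (g _), Algebra.commutes (ε b) (f _), Algebra.commutes (ε a)]
  abel

end AugmentedAlgebra

/-! ### Free and abelian `n`-Lie algebras. -/

namespace NLieAlg

variable {K : Type u} [CommRing K] {k : ℕ}

section FreeAbelian

variable (K k) in
/-- The module `Kᵐ` with zero bracket. -/
def freeAbelian (m : ℕ) : NLieAlg K k where
  carrier := Fin m → K
  bracket := 0
  fundamental _ _ := by simp

variable (K k) in
/-- The standard basis of `Kᵐ`. -/
def freeAbelian.basis (m : ℕ) (i : Fin m) : freeAbelian K k m := (Pi.single i 1 : Fin m → K)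

/-- For `m < n`, any `m` elements define a homomorphism from `Kᵐ`. -/
noncomputable def freeAbelian.lift {m : ℕ} (hm : m < k + 2) {L : NLieAlg K k} (v : Fin m → L) :
    freeAbelian K k m ⟶ L :=
  Hom.mk (L := freeAbelian K k m) (Fintype.linearCombination K v) fun x => by
    -- An alternating map is determined by injective tuples of basis vectors, and there are none of
    -- length `n > m`.
    have h : L.bracket.compLinearMap (Fintype.linearCombination K v) = 0 :=
      (Pi.basisFun K (Fin m)).ext_alternating fun w hw => by
        have := Fintype.card_le_of_injective w hw
        simp only [Fintype.card_fin] at this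
        omega
    refine (map_zero (Fintype.linearCombination K v)).trans ?_
    exact (congrArg (fun f : (Fin m → K) [⋀^Fin (k + 2)]→ₗ[K] L => f x) h).symm

theorem freeAbelian.lift_basis {m : ℕ} (hm : m < k + 2) {L : NLieAlg K k} (v : Fin m → L)
    (i : Fin m) : (freeAbelian.lift hm v).lin (freeAbelian.basis K k m i) = v i :=
  (Fintype.linearCombination_apply_single K v i 1).trans (one_smul K _)

theorem freeAbelian.hom_ext {m : ℕ} {L : NLieAlg K k} {f g : freeAbelian K k m ⟶ L}
    (h : ∀ i, f.lin (freeAbelian.basis K k m i) = g.lin (freeAbelian.basis K k m i)) : f = g :=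
  Hom.ext ((Pi.basisFun K (Fin m)).ext fun i => by
    rw [Pi.basisFun_apply]
    exact h i)

/-- With zero bracket the first relation of `U` says that the generators commute. -/
theorem mul_comm_assocAlg_freeAbelian (m : ℕ) (a b : AssocAlg (freeAbelian K k m)) :
    a * b = b * a := by
  have hgen : ∀ x y, (freeAbelian K k m).gen x * (freeAbelian K k m).gen y =
      (freeAbelian K k m).gen y * (freeAbelian K k m).gen x := fun x y => by
    rw [← sub_eq_zero, gen_commutator]
    exact Finset.sum_eq_zero fun i _ =>
      (genMap (freeAbelian K k m)).map_coord_zero i (by rw [Function.update_self]; rfl)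
  have h₁ : ∀ x b, b * (freeAbelian K k m).gen x = (freeAbelian K k m).gen x * b := fun x b => by
    have := mem_of_gen_mem (Subalgebra.centralizer K {(freeAbelian K k m).gen x})
      (fun y => Subalgebra.mem_centralizer_iff K |>.2 (by rintro _ rfl; exact hgen x y)) b
    exact ((Subalgebra.mem_centralizer_iff K).1 this _ rfl).symm
  have := mem_of_gen_mem (Subalgebra.centralizer K {a})
      (fun y => Subalgebra.mem_centralizer_iff K |>.2 (by rintro _ rfl; exact h₁ y _)) b
  exact (Subalgebra.mem_centralizer_iff K).1 this a rfl

end FreeAbelian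

theorem exists_lift_of_injective {L M N : NLieAlg K k} (f : L ⟶ N) (j : M ⟶ N)
    (hj : Function.Injective j.lin) (h : ∀ x, ∃ z, j.lin z = f.lin x) : ∃ u : L ⟶ M, u ≫ j = f := by
  choose u hu using h
  exact ⟨Hom.mk
    { toFun := u
      map_add' := fun x y => hj (by rw [map_add, hu, hu, hu, map_add])
      map_smul' := fun r x => hj (by rw [RingHom.id_apply, map_smul, hu, hu, map_smul]) }
    fun x => hj (by
      change j.lin (u _) = j.lin (M.bracket fun i => u (x i))
      rw [hu, j.map_bracket, f.map_bracket]
      simp only [hu]), hom_ext hu⟩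

/-! ### Left adjoint functors with the right module categories. -/

section Adjoint

variable {F : NLieAlg K k ⥤ AlgCat.{u} K} {G : AlgCat.{u} K ⥤ NLieAlg K k}

/-- The homomorphism from the image of the free algebra on one generator corresponding to an
element. -/
noncomputable def adjHom (adj : F ⊣ G) {B : AlgCat.{u} K} (z : G.obj B) :
    F.obj (freeAbelian K k 1) ⟶ B :=
  (adj.homEquiv _ _).symm (freeAbelian.lift (by omega) fun _ => z)

/-- The element corresponding to a homomorphism from the image of the free algebra on one
generator. -/
noncomputable def adjElem (adj : F ⊣ G) {B : AlgCat.{u} K}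
    (f : F.obj (freeAbelian K k 1) ⟶ B) : G.obj B :=
  (adj.homEquiv _ _ f).lin (freeAbelian.basis K k 1 0)

theorem adjElem_adjHom (adj : F ⊣ G) {B : AlgCat.{u} K} (z : G.obj B) :
    adjElem adj (adjHom adj z) = z := by
  rw [adjElem, adjHom, Equiv.apply_symm_apply, freeAbelian.lift_basis]

theorem adjHom_adjElem (adj : F ⊣ G) {B : AlgCat.{u} K} (f : F.obj (freeAbelian K k 1) ⟶ B) :
    adjHom adj (adjElem adj f) = f := by
  rw [adjHom, Equiv.symm_apply_eq]
  refine freeAbelian.hom_ext fun i => ?_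
  rw [freeAbelian.lift_basis, Subsingleton.elim i 0]
  rfl

theorem adjElem_comp (adj : F ⊣ G) {B C : AlgCat.{u} K}
    (f : F.obj (freeAbelian K k 1) ⟶ B) (j : B ⟶ C) :
    adjElem adj (f ≫ j) = (G.map j).lin (adjElem adj f) := by
  rw [adjElem, adj.homEquiv_naturality_right]
  rfl

theorem adjElem_map (adj : F ⊣ G) {L : NLieAlg K k} (x : L) :
    adjElem adj (F.map (freeAbelian.lift (K := K) (by omega) fun _ : Fin 1 => x)) =
      (adj.unit.app L).lin x := by
  have : F.map (freeAbelian.lift (K := K) (by omega) fun _ : Fin 1 => x) =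
      F.map (freeAbelian.lift (K := K) (by omega) fun _ : Fin 1 => x) ≫ 𝟙 _ :=
    (Category.comp_id _).symm
  rw [this, adjElem, adj.homEquiv_naturality_left, adj.homEquiv_id, comp_lin,
    LinearMap.comp_apply, freeAbelian.lift_basis]

/-- A subalgebra of `F L` through which all maps induced by elements of `L` factor is everything. -/
theorem mem_of_range_le (adj : F ⊣ G) (L : NLieAlg K k) (C : Subalgebra K (F.obj L))
    (hC : ∀ (x : L) a, (F.map (freeAbelian.lift (K := K) (by omega) fun _ : Fin 1 => x)).hom a ∈ C)
    (b : F.obj L) : b ∈ C := by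
  let j : AlgCat.of K C ⟶ F.obj L := AlgCat.ofHom C.val
  -- Elements of `G B` correspond to maps `F(K) ⟶ B`, so `G` preserves injectivity. The unit of the
  -- adjunction then factors through `G C`, and its transpose is a section of the inclusion of `C`.
  have hj : Function.Injective (G.map j).lin := fun z z' h => by
    rw [← adjElem_adjHom adj z, ← adjElem_adjHom adj z', ← adjElem_comp, ← adjElem_comp] at h
    have h' := congrArg (adjHom adj) h
    rw [adjHom_adjElem, adjHom_adjElem] at h'
    have : adjHom adj z = adjHom adj z' := by
      refine AlgCat.hom_ext _ (AlgHom.ext fun a => Subtype.ext ?_)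
      exact congrArg (fun φ : F.obj (freeAbelian K k 1) ⟶ F.obj L => φ.hom a) h'
    rw [← adjElem_adjHom adj z, this, adjElem_adjHom]
  obtain ⟨u, hu⟩ := exists_lift_of_injective (adj.unit.app L) (G.map j) hj fun x => by
    refine ⟨adjElem adj (B := AlgCat.of K C) (AlgCat.ofHom (AlgHom.codRestrict _ C (hC x))), ?_⟩
    rw [← adjElem_comp, ← adjElem_map]
    rfl
  have h : (adj.homEquiv _ _).symm u ≫ j = 𝟙 _ := by
    rw [← adj.homEquiv_naturality_right_symm, hu, Equiv.symm_apply_eq]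
    exact (adj.homEquiv_id L).symm
  have hb : j.hom (((adj.homEquiv _ _).symm u).hom b) = b :=
    congrArg (fun φ : F.obj L ⟶ F.obj L => φ.hom b) h
  rw [← hb]
  exact (((adj.homEquiv _ _).symm u).hom b).2

theorem exists_extension (adj : F ⊣ G) (hk : 2 < k + 2) {B : AlgCat.{u} K}
    (f g : F.obj (freeAbelian K k 1) ⟶ B) :
    ∃ φ : F.obj (freeAbelian K k 2) ⟶ B,
      F.map (freeAbelian.lift (K := K) (by omega) fun _ : Fin 1 =>
        freeAbelian.basis K k 2 0) ≫ φ = f ∧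
      F.map (freeAbelian.lift (K := K) (by omega) fun _ : Fin 1 =>
        freeAbelian.basis K k 2 1) ≫ φ = g := by
  refine ⟨(adj.homEquiv _ _).symm (freeAbelian.lift hk ![adjElem adj f, adjElem adj g]), ?_, ?_⟩
  · rw [← adj.homEquiv_naturality_left_symm, Equiv.symm_apply_eq]
    refine freeAbelian.hom_ext fun i => ?_
    rw [comp_lin, LinearMap.comp_apply, freeAbelian.lift_basis, freeAbelian.lift_basis,
      Subsingleton.elim i 0]
    rfl
  · rw [← adj.homEquiv_naturality_left_symm, Equiv.symm_apply_eq]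
    refine freeAbelian.hom_ext fun i => ?_
    rw [comp_lin, LinearMap.comp_apply, freeAbelian.lift_basis, freeAbelian.lift_basis,
      Subsingleton.elim i 0]
    rfl

/-- The values of a left adjoint functor with the right module categories are commutative. -/
theorem mul_comm_of_adjunction (adj : F ⊣ G) (hk : 2 < k + 2)
    (e : ModuleCat.{u} (AssocAlg (freeAbelian K k 2)) ≌ ModuleCat.{u} (F.obj (freeAbelian K k 2)))
    (L : NLieAlg K k) (a b : F.obj L) : a * b = b * a := by
  -- The augmentation corresponds to the element `0` of `G K`.
  let ε : F.obj (freeAbelian K k 1) →ₐ[K] K := (adjHom adj (B := AlgCat.of K K) 0).hom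
  have ht := fun a b ha hb => tmul_eq_zero_of_equivalence ε (mul_comm_assocAlg_freeAbelian 2) e
    (F.map (freeAbelian.lift (K := K) (by omega) fun _ : Fin 1 => freeAbelian.basis K k 2 0)).hom
    (F.map (freeAbelian.lift (K := K) (by omega) fun _ : Fin 1 => freeAbelian.basis K k 2 1)).hom
    (fun T _ _ f g => by
      obtain ⟨φ, h₁, h₂⟩ := exists_extension adj hk (AlgCat.ofHom f) (AlgCat.ofHom g)
      exact ⟨φ.hom, congrArg AlgCat.Hom.hom h₁, congrArg AlgCat.Hom.hom h₂⟩) (a := a) (b := b) ha hb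
  have h₁ : ∀ (x : L) c (b : F.obj L),
      b * (F.map (freeAbelian.lift (K := K) (by omega) fun _ : Fin 1 => x)).hom c =
        (F.map (freeAbelian.lift (K := K) (by omega) fun _ : Fin 1 => x)).hom c * b := fun x c b => by
    have := mem_of_range_le adj L (Subalgebra.centralizer K
      {(F.map (freeAbelian.lift (K := K) (by omega) fun _ : Fin 1 => x)).hom c})
      (fun y d => (Subalgebra.mem_centralizer_iff K).2 (by
        rintro _ rfl
        exact AlgHom.commute_of_tmul_eq_zero ε ht _ _ c d)) b
    exact ((Subalgebra.mem_centralizer_iff K).1 this _ rfl).symm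
  have := mem_of_range_le adj L (Subalgebra.centralizer K {a})
    (fun y d => (Subalgebra.mem_centralizer_iff K).2 (by rintro _ rfl; exact h₁ y d _)) b
  exact (Subalgebra.mem_centralizer_iff K).1 this a rfl

theorem not_adjunction [Nontrivial K] (hk : 2 < k + 2)
    (h : ∀ L : NLieAlg K k, Nonempty (LMod L ≌ ModuleCat.{u} (F.obj L))) : IsEmpty (F ⊣ G) := by
  refine ⟨fun adj => ?_⟩
  have e : ∀ L : NLieAlg K k, Nonempty (ModuleCat.{u} (AssocAlg L) ≌ ModuleCat.{u} (F.obj L)) :=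
    fun L => ⟨(nonempty_equivalence L).some.symm.trans (h L).some⟩
  exact (isEmpty_equivalence_detAlg (K := K) (k := k)
    (mul_comm_of_adjunction adj hk (e _).some (detAlg K k))).false (e _).some.symm

end Adjoint

/-! ### The case `n = 2`: the commutator functor. -/

section Commutator

/-- The commutator as an alternating map. -/
noncomputable def commutatorMap (B : Type*) [Ring B] [Algebra K B] : B [⋀^Fin 2]→ₗ[K] B :=
  MultilinearMap.alternatization (MultilinearMap.mkPiAlgebraFin K 2 B)

theorem commutatorMap_apply {B : Type*} [Ring B] [Algebra K B] (v : Fin 2 → B) :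
    commutatorMap (K := K) B v = v 0 * v 1 - v 1 * v 0 := by
  rw [commutatorMap, MultilinearMap.alternatization_apply]
  have h : (Finset.univ : Finset (Equiv.Perm (Fin 2))) = {1, Equiv.swap 0 1} := by decide
  rw [h, Finset.sum_pair (by decide)]
  simp [List.ofFn_succ, sub_eq_add_neg]

variable (K) in
/-- The commutator Lie algebra of an associative algebra. -/
noncomputable def ofAlgebra (B : Type u) [Ring B] [Algebra K B] : NLieAlg K 0 where
  carrier := B
  bracket := commutatorMap B
  fundamental x y := by
    have key : ∀ (x : Fin 2 → B) (y : Fin 1 → B),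
        commutatorMap (K := K) B (Fin.cons (commutatorMap (K := K) B x) y) =
          ∑ i, commutatorMap (K := K) B (Function.update x i
            (commutatorMap (K := K) B (Fin.cons (x i) y))) := fun x y => by
      rw [Fin.sum_univ_two]
      simp only [commutatorMap_apply, Fin.cons_zero, Fin.cons_one, Function.update_self, ne_eq,
        Fin.reduceEq, not_false_eq_true, Function.update_of_ne]
      noncomm_ring
    exact key x y

theorem ofAlgebra_bracket (B : Type u) [Ring B] [Algebra K B] (v : Fin 2 → B) :
    (ofAlgebra K B).bracket v = (v 0 * v 1 - v 1 * v 0 : B) := commutatorMap_apply v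

theorem _root_.AlgHom.map_commutator {A B : Type*} [Ring A] [Algebra K A] [Ring B] [Algebra K B]
    (f : A →ₐ[K] B) (a b : A) : f (a * b - b * a) = f a * f b - f b * f a := by
  rw [map_sub, map_mul, map_mul]

/-- A homomorphism to a commutator Lie algebra. -/
noncomputable def homOfAlgebra {L : NLieAlg K 0} {B : Type u} [Ring B] [Algebra K B]
    (f : L →ₗ[K] B)
    (hf : ∀ v : Fin 2 → L, f (L.bracket v) = f (v 0) * f (v 1) - f (v 1) * f (v 0)) :
    L ⟶ ofAlgebra K B :=
  Hom.mk (L' := ofAlgebra K B) f fun v => (hf v).trans (ofAlgebra_bracket B fun i => f (v i)).symm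

variable (K) in
/-- The commutator functor from associative algebras to Lie algebras. -/
noncomputable def commutatorFunctor : AlgCat.{u} K ⥤ NLieAlg K 0 where
  obj B := ofAlgebra K B
  map {B C} f := homOfAlgebra (L := ofAlgebra K B) f.hom.toLinearMap fun v => by
    exact (congrArg f.hom (ofAlgebra_bracket B v)).trans (f.hom.map_commutator _ _)
  map_id _ := rfl
  map_comp _ _ := rfl

/-- A linear map, considered as an alternating map in one variable. -/
noncomputable def uncurryOne {L : NLieAlg K 0} {B : Type u} [Ring B] [Algebra K B] (f : L →ₗ[K] B) :
    L [⋀^Fin 1]→ₗ[K] B :=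
  f.compAlternatingMap (AlternatingMap.ofSubsingleton K L L (0 : Fin 1) LinearMap.id)

/-- For `n = 2` both relations of `U` say that brackets go to commutators. -/
theorem isAssocMap_uncurryOne {L : NLieAlg K 0} {B : Type u} [Ring B] [Algebra K B]
    {f : L →ₗ[K] B}
    (hf : ∀ v : Fin 2 → L, f (L.bracket v) = f (v 0) * f (v 1) - f (v 1) * f (v 0)) :
    IsAssocMap (uncurryOne f) where
  commutator x y := by
    rw [Fin.sum_univ_one]
    change _ = f (Function.update y 0 (L.bracket (Fin.snoc (α := fun _ => L.carrier) x (y 0))) 0)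
    rw [Function.update_self, hf]
    rfl
  bracket x y := by
    rw [Fin.sum_univ_two]
    change f (L.bracket x) = (-1 : ℤ) ^ 1 • (f (x 1) * f (x 0)) + (-1 : ℤ) ^ 0 • (f (x 0) * f (x 1))
    rw [hf]
    simp [sub_eq_add_neg, add_comm]

/-- The map from a Lie algebra to its associated algebra. -/
noncomputable def genOne (L : NLieAlg K 0) : L →ₗ[K] AssocAlg L :=
  (AlternatingMap.ofSubsingleton K L (AssocAlg L) (0 : Fin 1)).symm (genMap L)

theorem genOne_apply {L : NLieAlg K 0} (x : L) : genOne L x = L.gen fun _ => x := rfl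

theorem gen_eq_genOne {L : NLieAlg K 0} (x : Fin 1 → L) : L.gen x = genOne L (x 0) := by
  rw [genOne_apply]
  congr 1
  funext i
  rw [Subsingleton.elim i 0]

theorem genOne_bracket {L : NLieAlg K 0} (v : Fin 2 → L) :
    genOne L (L.bracket v) = genOne L (v 0) * genOne L (v 1) - genOne L (v 1) * genOne L (v 0) := by
  have h := gen_bracket v Fin.elim0
  rw [Fin.sum_univ_two] at h
  simp only [gen_eq_genOne, Fin.cons_zero] at h
  rw [h]
  simp [sub_eq_add_neg, add_comm]

/-- The linear map underlying a homomorphism to a commutator Lie algebra. -/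
def linOfAlgebra {L : NLieAlg K 0} {B : Type u} [Ring B] [Algebra K B]
    (f : L ⟶ ofAlgebra K B) : L →ₗ[K] B := f.lin

theorem linOfAlgebra_bracket {L : NLieAlg K 0} {B : Type u} [Ring B] [Algebra K B]
    (f : L ⟶ ofAlgebra K B) (v : Fin 2 → L) :
    linOfAlgebra f (L.bracket v) = linOfAlgebra f (v 0) * linOfAlgebra f (v 1) -
      linOfAlgebra f (v 1) * linOfAlgebra f (v 0) :=
  (f.map_bracket v).trans (ofAlgebra_bracket B _)

/-- The algebra homomorphism extending a homomorphism to a commutator Lie algebra. -/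
noncomputable def liftOfAlgebra {L : NLieAlg K 0} {B : Type u} [Ring B] [Algebra K B]
    (f : L ⟶ ofAlgebra K B) : AssocAlg L →ₐ[K] B :=
  assocLift _ (isAssocMap_uncurryOne (linOfAlgebra_bracket f))

theorem liftOfAlgebra_gen {L : NLieAlg K 0} {B : Type u} [Ring B] [Algebra K B]
    (f : L ⟶ ofAlgebra K B) (x : Fin 1 → L) : liftOfAlgebra f (L.gen x) = linOfAlgebra f (x 0) :=
  assocLift_gen _ _ x

/-- The associated algebra of a Lie algebra is left adjoint to the commutator functor. -/
noncomputable def assocAdjunction : assocFunctor K 0 ⊣ commutatorFunctor K :=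
  Adjunction.mkOfHomEquiv
    { homEquiv := fun L B =>
        { toFun := fun φ => homOfAlgebra (φ.hom.toLinearMap ∘ₗ genOne L) fun v => by
            change φ.hom (genOne L (L.bracket v)) = _
            exact (congrArg φ.hom (genOne_bracket v)).trans (φ.hom.map_commutator _ _)
          invFun := fun f => AlgCat.ofHom (liftOfAlgebra (B := B) f)
          left_inv := fun φ => AlgCat.hom_ext _ (assocAlg_hom_ext fun x =>
            (liftOfAlgebra_gen (B := B) _ x).trans (congrArg φ.hom (gen_eq_genOne x).symm))
          right_inv := fun f => hom_ext fun x => liftOfAlgebra_gen (B := B) f _ }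
      homEquiv_naturality_left_symm := fun {L' L B} f g => AlgCat.hom_ext _
        (assocAlg_hom_ext fun x => by
          refine (liftOfAlgebra_gen (B := B) (f ≫ g) x).trans ?_
          refine Eq.trans ?_ (congrArg (liftOfAlgebra (B := B) g) (assocMap_gen f x)).symm
          exact (liftOfAlgebra_gen (B := B) g fun i => f.lin (x i)).symm)
      homEquiv_naturality_right := fun _ _ => rfl }

end Commutator

end NLieAlg

/-! ### The main theorem. -/

theorem mainTheorem1 (K : Type u) [CommRing K] [Nontrivial K] (k : ℕ) :
    (∀ L : NLieAlg K k,
      Nonempty (NLieAlg.LMod L ≌ ModuleCat.{u} ((NLieAlg.assocFunctor K k).obj L))) ∧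
    ((∃ G : AlgCat.{u} K ⥤ NLieAlg K k, Nonempty (NLieAlg.assocFunctor K k ⊣ G)) ↔ k + 2 = 2) ∧
    (2 < k + 2 →
      ¬ ∃ (F : NLieAlg K k ⥤ AlgCat.{u} K) (G : AlgCat.{u} K ⥤ NLieAlg K k),
        Nonempty (F ⊣ G) ∧
          ∀ L : NLieAlg K k, Nonempty (NLieAlg.LMod L ≌ ModuleCat.{u} (F.obj L))) := by
  have hmod : ∀ L : NLieAlg K k,
      Nonempty (NLieAlg.LMod L ≌ ModuleCat.{u} ((NLieAlg.assocFunctor K k).obj L)) :=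
    NLieAlg.nonempty_equivalence
  refine ⟨hmod, ⟨?_, ?_⟩, ?_⟩
  · rintro ⟨G, ⟨adj⟩⟩
    by_contra hk
    exact (NLieAlg.not_adjunction (by omega) hmod).false adj
  · intro hk
    obtain rfl : k = 0 := by omega
    exact ⟨NLieAlg.commutatorFunctor K, ⟨NLieAlg.assocAdjunction⟩⟩
  · rintro hk ⟨F, G, ⟨adj⟩, h⟩
    exact (NLieAlg.not_adjunction hk h).false adj
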